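/- Let $\mathcal V$ be the free associative $\mathbb Q$-algebra on $e_0,e_1$, graded by $\deg e_0=\deg e_1=1$; for $x\in\mathcal V$ write $x[d]$ for its component of degree $d$ and $(x|w)$ for the coefficient of a word $w$ in $e_0,e_1$. Let $\mathcal V_0\subset\mathcal V$ be the span of the words of positive length and $\mathfrak{lie}(e_0,e_1)\subset\mathcal V_0$ the Lie subalgebra (for the commutator) generated by $e_0,e_1$. For $x\in\mathfrak{lie}(e_0,e_1)$ put $$\theta(x)=x-(x|e_0)e_0+\sum_{n\ge1}\tfrac1n\,(x|e_0^{n-1}e_1)\,e_1^n\in\mathcal V_0 .$$ Let $\mathcal W=\mathbb Q\oplus\mathcal Ve_1$, a subalgebra of $\mathcal V$ freely generated by $\tilde y_n=e_0^{n-1}e_1$ ($n\ge1$), put $\tilde y_0=-1$, and let $\Delta^{\mathcal W}:\mathcal W\to\mathcal W^{\otimes2}$ be the algebra morphism with $\Delta^{\mathcal W}(\tilde y_n)=-\sum_{i=0}^n\tilde y_i\otimes\tilde y_{n-i}$ for $n\ge1$. Let $\mathcal M=\mathcal V/\mathcal Ve_0$, let $1_{\mathcal M}$ be the class of $1$, and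 write $v\cdot1_{\mathcal M}$ for the class of $v\in\mathcal V$. The map $\mathcal W\to\mathcal M$, $w\mapsto w\cdot1_{\mathcal M}$ is bijective; let $\Delta^{\mathcal M}:\mathcal M\to\mathcal M^{\otimes2}$ be the linear map with $\Delta^{\mathcal M}(w\cdot1_{\mathcal M})=\Delta^{\mathcal W}(w)\cdot(1_{\mathcal M}\otimes1_{\mathcal M})$ for all $w\in\mathcal W$, and put $$\mathcal P(\mathcal M)=\{m\in\mathcal M\mid\Delta^{\mathcal M}(m)=m\otimes1_{\mathcal M}+1_{\mathcal M}\otimes m\}.$$ For $v\in\mathcal V_0$ let $\mathrm{der}^{(1)}_v$ be the derivation of the algebra $\mathcal V$ with $e_0\mapsto[v,e_0]$, $e_1\mapsto0$, and let $\mathrm{der}^{\mathcal M,(10)}_v$ be the endomorphism of the vector space $\mathcal M$ induced by $a\mapsto\mathrm{der}^{(1)}_v(a)+av$ (which preserves $\mathcal Ve_0$). Let $$\mathfrak{stab}_{\mathfrak{lie}(e_0,e_1)}(\Delta^{\mathcal M})=\{x\in\mathfrak{lie}(e_0,e_1)\mid (D_x\otimes\mathrm{id}+\mathrm{id}\otimes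 D_x)\circ\Delta^{\mathcal M}=\Delta^{\mathcal M}\circ D_x\},\qquad D_x=\mathrm{der}^{\mathcal M,(10)}_{\theta(x)} .$$ **Proposition 3.2.** With $\mathfrak{lie}(e_0,e_1)[\check2]=\{x\in\mathfrak{lie}(e_0,e_1)\mid x[2]=0\}$, one has $$\mathfrak{stab}_{\mathfrak{lie}(e_0,e_1)}(\Delta^{\mathcal M})=\theta^{-1}\Big((-\cdot1_{\mathcal M})^{-1}(\mathcal P(\mathcal M))\Big)\cap\mathfrak{lie}(e_0,e_1)[\check2].$$ In other terms, $$\mathfrak{stab}_{\mathfrak{lie}(e_0,e_1)}(\Delta^{\mathcal M})=\{x\in\mathfrak{lie}(e_0,e_1)\mid x[2]=0\text{ and }\theta(x)\cdot1_{\mathcal M}\in\mathcal P(\mathcal M)\}.$$ -/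

import Mathlib

open scoped TensorProduct

namespace HarmCoprod

noncomputable section

/-! ## The free algebra `𝒱`, words, degrees and the Lie algebra `𝔩𝔦𝔢(e₀, e₁)` -/

/-- The free associative `ℚ`-algebra `𝒱` on two generators. -/
abbrev V : Type := FreeAlgebra ℚ (Fin 2)

attribute [local instance] LieRing.ofAssociativeRing

/-- The generator `e₀`. -/
def e0 : V := FreeAlgebra.ι ℚ 0

/-- The generator `e₁`. -/
def e1 : V := FreeAlgebra.ι ℚ 1

/-- The basis of `𝒱` given by the words in `e₀, e₁` (letter `0` is `e₀`, letter `1` is `e₁`). -/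
def wordBasis : Module.Basis (FreeMonoid (Fin 2)) ℚ V := FreeAlgebra.basisFreeMonoid ℚ (Fin 2)

theorem wordBasis_eq (w : FreeMonoid (Fin 2)) :
    wordBasis w = FreeMonoid.lift (FreeAlgebra.ι ℚ) w := by
  simp [wordBasis, FreeAlgebra.basisFreeMonoid, FreeAlgebra.equivMonoidAlgebraFreeMonoid,
    MonoidAlgebra.lift_single]

theorem wordBasis_mul (w w' : FreeMonoid (Fin 2)) :
    wordBasis (w * w') = wordBasis w * wordBasis w' := by
  simp [wordBasis_eq]

theorem wordBasis_of_zero : wordBasis (FreeMonoid.of 0) = e0 := by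
  simp [wordBasis_eq, e0]

theorem wordBasis_of_one : wordBasis (FreeMonoid.of 1) = e1 := by
  simp [wordBasis_eq, e1]

theorem wordBasis_one : wordBasis 1 = 1 := by
  simp [wordBasis_eq]

/-- The coefficient `(x | w)` of the word `w` in `x ∈ 𝒱`. -/
def coeff (w : FreeMonoid (Fin 2)) : V →ₗ[ℚ] ℚ := wordBasis.coord w

/-- `x ↦ x[d]`, the projection of `𝒱` to its component of degree `d`
(`e₀` and `e₁` have degree `1`, so that words have their length as degree). -/
def degComp (d : ℕ) : V →ₗ[ℚ] V :=
  wordBasis.constr ℚ fun w => if w.length = d then wordBasis w else 0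

/-- The Lie subalgebra `𝔩𝔦𝔢(e₀, e₁)` of `𝒱` (with the commutator bracket) generated by
`e₀` and `e₁`. -/
abbrev lie : LieSubalgebra ℚ V := LieSubalgebra.lieSpan ℚ V {e0, e1}

/-- The subspace of `𝔩𝔦𝔢(e₀, e₁)` of all `x` with `x[d] = 0`. -/
def lieCheck (d : ℕ) : Submodule ℚ lie :=
  LinearMap.ker (degComp d ∘ₗ lie.toSubmodule.subtype)

/-! ## The derivations `der_v^{𝒱,(1)}` and the endomorphisms `der_v^{𝒱,(10)}` -/

/-- The algebra morphism `a ↦ (a, der_v(a))` to the square-zero extension of `𝒱` by the bimodule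
`𝒱`, given by `e₀ ↦ (e₀, [v, e₀])` and `e₁ ↦ (e₁, 0)`. -/
def der1Hom (v : V) : V →ₐ[ℚ] TrivSqZeroExt V V :=
  FreeAlgebra.lift ℚ fun i : Fin 2 =>
    if i = 0 then TrivSqZeroExt.inl e0 + TrivSqZeroExt.inr ⁅v, e0⁆ else TrivSqZeroExt.inl e1

theorem der1Hom_fst (v a : V) : (der1Hom v a).fst = a := by
  have h : (TrivSqZeroExt.fstHom ℚ V V).comp (der1Hom v) = AlgHom.id ℚ V := by
    apply FreeAlgebra.hom_ext
    funext i
    fin_cases i <;> simp [der1Hom, e0, e1]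
  exact DFunLike.congr_fun h a

/-- The derivation `der_v^{𝒱,(1)}` of the algebra `𝒱`. -/
def der1 (v : V) : V →ₗ[ℚ] V where
  toFun a := (der1Hom v a).snd
  map_add' a b := by simp
  map_smul' c a := by simp

/-- `der_v^{𝒱,(1)}` is a derivation. -/
theorem der1_mul (v a b : V) : der1 v (a * b) = der1 v a * b + a * der1 v b := by
  simp [der1, der1Hom_fst, add_comm]

/-- `der_v^{𝒱,(1)}` maps `e₀` to `[v, e₀]`. -/
theorem der1_e0 (v : V) : der1 v e0 = ⁅v, e0⁆ := by
  simp [der1, der1Hom, e0]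

/-- `der_v^{𝒱,(1)}` maps `e₁` to `0`. -/
theorem der1_e1 (v : V) : der1 v e1 = 0 := by
  simp [der1, der1Hom, e1]

theorem der1_algebraMap (v : V) (c : ℚ) : der1 v (algebraMap ℚ V c) = 0 := by
  simp [der1, TrivSqZeroExt.algebraMap_eq_inl']

theorem der1_add (v w : V) : der1 (v + w) = der1 v + der1 w := by
  ext a
  induction a using FreeAlgebra.induction with
  | grade0 r => simp [der1_algebraMap]
  | grade1 i =>
    fin_cases i
    · change der1 _ e0 = der1 _ e0 + der1 _ e0
      rw [der1_e0, der1_e0, der1_e0, add_lie]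
    · change der1 _ e1 = der1 _ e1 + der1 _ e1
      simp [der1_e1]
  | mul a b ha hb =>
    simp only [LinearMap.add_apply, der1_mul] at *
    rw [ha, hb]; noncomm_ring
  | add a b ha hb => rw [map_add, ha, hb, map_add]

theorem der1_smul (c : ℚ) (v : V) : der1 (c • v) = c • der1 v := by
  ext a
  induction a using FreeAlgebra.induction with
  | grade0 r => simp [der1_algebraMap]
  | grade1 i =>
    fin_cases i
    · change der1 _ e0 = c • der1 _ e0
      rw [der1_e0, der1_e0, smul_lie]
    · change der1 _ e1 = c • der1 _ e1
      simp [der1_e1]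
  | mul a b ha hb =>
    simp only [LinearMap.smul_apply, der1_mul] at *
    rw [ha, hb]; simp
  | add a b ha hb => rw [map_add, ha, hb, map_add]

/-- The endomorphism `der_v^{𝒱,(10)} : a ↦ der_v^{𝒱,(1)}(a) + a v` of the vector space `𝒱`. -/
def der10 (v : V) : V →ₗ[ℚ] V := der1 v + LinearMap.mulRight ℚ v

theorem der10_apply (v a : V) : der10 v a = der1 v a + a * v := by
  simp [der10]

/-! ## The map `θ` -/

/-- The word `e₀ⁿ e₁`. -/
def word01 (n : ℕ) : FreeMonoid (Fin 2) := FreeMonoid.of 0 ^ n * FreeMonoid.of 1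

theorem word01_injective : Function.Injective word01 := by
  intro m n h
  have h' := congrArg (FreeMonoid.lift fun _ : Fin 2 => Multiplicative.ofAdd (1 : ℕ)) h
  simpa [word01, ← ofAdd_nsmul, ← ofAdd_add] using h'

/-- The linear map `x ↦ ∑_{n ≥ 1} (1/n) (x | e₀ⁿ⁻¹ e₁) e₁ⁿ` (with `n - 1` as index). -/
def thetaCorr : V →ₗ[ℚ] V :=
  Finsupp.linearCombination ℚ (fun n : ℕ => (1 / ((n : ℚ) + 1)) • e1 ^ (n + 1)) ∘ₗ
    Finsupp.lcomapDomain word01 word01_injective ∘ₗ wordBasis.repr.toLinearMap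

theorem thetaCorr_apply (x : V) :
    thetaCorr x =
      ∑ᶠ n : ℕ, ((1 / ((n : ℚ) + 1)) * coeff (word01 n) x) • e1 ^ (n + 1) := by
  rw [finsum_eq_sum_of_support_subset
    (s := (Finsupp.lcomapDomain (R := ℚ) word01 word01_injective (wordBasis.repr x)).support)]
  · simp only [thetaCorr, LinearMap.comp_apply, Finsupp.linearCombination_apply, Finsupp.sum]
    refine Finset.sum_congr rfl fun n _ => ?_
    simp [smul_smul, mul_comm, coeff]
  · intro n hn
    simp only [Function.mem_support] at hn
    simp only [Finset.mem_coe, Finsupp.mem_support_iff]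
    intro h0
    apply hn
    have : coeff (word01 n) x = 0 := h0
    simp [this]

/-- The map `θ : 𝔩𝔦𝔢(e₀, e₁) → 𝒱`,
`θ(x) = x - (x | e₀) e₀ + ∑_{n ≥ 1} (1/n) (x | e₀ⁿ⁻¹ e₁) e₁ⁿ`. -/
def theta : lie →ₗ[ℚ] V :=
  (LinearMap.id - (coeff (FreeMonoid.of 0)).smulRight e0 + thetaCorr) ∘ₗ lie.toSubmodule.subtype

theorem theta_apply (x : lie) :
    theta x = (x : V) - coeff (FreeMonoid.of 0) (x : V) • e0 +
      ∑ᶠ n : ℕ, ((1 / ((n : ℚ) + 1)) * coeff (word01 n) (x : V)) • e1 ^ (n + 1) := by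
  rw [← thetaCorr_apply]; rfl

/-! ## The algebra `𝒲` and the coproduct `Δ^𝒲` -/

/-- The subalgebra `𝒲 = ℚ ⊕ 𝒱 e₁` of `𝒱`. -/
def W : Subalgebra ℚ V where
  carrier := {w | ∃ (c : ℚ) (v : V), w = algebraMap ℚ V c + v * e1}
  mul_mem' := by
    rintro _ _ ⟨c, v, rfl⟩ ⟨c', v', rfl⟩
    refine ⟨c * c', algebraMap ℚ V c * v' + v * algebraMap ℚ V c' + v * e1 * v', ?_⟩
    have h : v * e1 * algebraMap ℚ V c' = v * algebraMap ℚ V c' * e1 := by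
      rw [mul_assoc, ← Algebra.commutes c' e1, mul_assoc]
    rw [map_mul, add_mul, mul_add, mul_add, h]
    noncomm_ring
  add_mem' := by
    rintro _ _ ⟨c, v, rfl⟩ ⟨c', v', rfl⟩
    exact ⟨c + c', v + v', by rw [map_add, add_mul]; abel⟩
  algebraMap_mem' c := ⟨c, 0, by simp⟩

theorem mul_e1_mem (v : V) : v * e1 ∈ W := ⟨0, v, by simp⟩

/-- The elements `ỹₙ` of `𝒲`: `ỹ₀ = -1` and `ỹₙ = e₀ⁿ⁻¹ e₁` for `n > 0`. -/
def yTilde : ℕ → W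
  | 0 => -1
  | n + 1 => ⟨e0 ^ n * e1, mul_e1_mem _⟩

section FreeW

variable {A : Type} [Ring A] [Algebra ℚ A] (f : ℕ → A)

/-- Auxiliary action of `𝒱` on sequences in `A`:
`(e₀ g)(n) = g(n+1)` and `(e₁ g)(n) = f(n+1) g(0)`. -/
def seqAction : V →ₐ[ℚ] Module.End ℚ (ℕ → A) :=
  FreeAlgebra.lift ℚ fun i : Fin 2 =>
    if i = 0 then
      { toFun := fun g n => g (n + 1), map_add' := fun _ _ => rfl, map_smul' := fun _ _ => rfl }
    else
      { toFun := fun g n => f (n + 1) * g 0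
        map_add' := fun _ _ => by funext n; simp [mul_add]
        map_smul' := fun _ _ => by funext n; simp }

theorem seqAction_e0 (g : ℕ → A) : seqAction f e0 g = fun n => g (n + 1) := by
  simp [seqAction, e0]

theorem seqAction_e1 (g : ℕ → A) : seqAction f e1 g = fun n => f (n + 1) * g 0 := by
  simp [seqAction, e1]

theorem seqAction_mul_right (v : V) (g : ℕ → A) (a : A) :
    seqAction f v (fun n => g n * a) = fun n => seqAction f v g n * a := by
  induction v using FreeAlgebra.induction generalizing g with
  | grade0 r => funext n; simp [Algebra.algebraMap_eq_smul_one]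
  | grade1 i =>
    fin_cases i
    · change seqAction f e0 _ = fun n => seqAction f e0 _ _ * a
      simp [seqAction_e0]
    · change seqAction f e1 _ = fun n => seqAction f e1 _ _ * a
      simp [seqAction_e1, mul_assoc]
  | mul x y hx hy => simp only [map_mul, Module.End.mul_apply, hy, hx]
  | add x y hx hy => funext n; simp [hx, hy, add_mul]

theorem seqAction_W (w : W) (g : ℕ → A) :
    seqAction f w g 0 = seqAction f w (fun _ => 1) 0 * g 0 := by
  obtain ⟨_, c, v, rfl⟩ := w
  have h : seqAction f e1 g = fun n => seqAction f e1 (fun _ => 1) n * g 0 := by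
    simp [seqAction_e1]
  simp only [map_add, map_mul, LinearMap.add_apply, Module.End.mul_apply, Pi.add_apply, h,
    seqAction_mul_right]
  simp [Algebra.algebraMap_eq_smul_one, add_mul]

/-- The algebra `𝒲` is freely generated by `ỹ₁, ỹ₂, …`: the algebra morphism `𝒲 → A` such that
`ỹₙ ↦ f n` for `n > 0`. -/
def liftW : W →ₐ[ℚ] A :=
  AlgHom.ofLinearMap
    { toFun := fun w => seqAction f w (fun _ => 1) 0
      map_add' := fun w w' => by simp
      map_smul' := fun c w => by simp }
    (by simp)
    (fun w w' => by
      change seqAction f ((w : V) * w') _ 0 = _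
      rw [map_mul, Module.End.mul_apply, seqAction_W]
      rfl)

theorem liftW_yTilde (n : ℕ) : liftW f (yTilde (n + 1)) = f (n + 1) := by
  have h : ∀ (k : ℕ) (g : ℕ → A) (m : ℕ), seqAction f (e0 ^ k) g m = g (m + k) := by
    intro k
    induction k with
    | zero => intro g m; simp
    | succ k ih =>
      intro g m
      rw [pow_succ, map_mul, Module.End.mul_apply, ih, seqAction_e0]
      rfl
  change seqAction f (e0 ^ n * e1) _ 0 = _
  rw [map_mul, Module.End.mul_apply, h, seqAction_e1]
  simp

end FreeW

/-- The algebra morphism `Δ^𝒲 : 𝒲 → 𝒲 ⊗ 𝒲` with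
`Δ^𝒲(ỹₙ) = - ∑_{i=0}^n ỹᵢ ⊗ ỹₙ₋ᵢ` for `n > 0`. -/
def DeltaW : W →ₐ[ℚ] W ⊗[ℚ] W :=
  liftW fun n => -∑ i ∈ Finset.range (n + 1), yTilde i ⊗ₜ[ℚ] yTilde (n - i)

theorem DeltaW_yTilde (n : ℕ) (hn : 0 < n) :
    DeltaW (yTilde n) = -∑ i ∈ Finset.range (n + 1), yTilde i ⊗ₜ[ℚ] yTilde (n - i) := by
  obtain ⟨n, rfl⟩ : ∃ m, n = m + 1 := ⟨n - 1, by omega⟩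
  exact liftW_yTilde _ n

/-! ## The module `ℳ`, its endomorphisms `der_v^{ℳ,(10)}` and the coproduct `Δ^ℳ` -/

/-- The subspace (left ideal) `𝒱 e₀` of `𝒱`. -/
def Ve0 : Submodule ℚ V := LinearMap.range (LinearMap.mulRight ℚ e0)

theorem mem_Ve0 (v : V) : v ∈ Ve0 ↔ ∃ a, a * e0 = v := by
  simp [Ve0]

/-- The quotient `ℳ = 𝒱 / 𝒱 e₀`. -/
def M : Type := V ⧸ Ve0

instance : AddCommGroup M := Submodule.Quotient.addCommGroup Ve0

instance : Module ℚ M := Submodule.Quotient.module Ve0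

/-- The canonical projection `𝒱 → ℳ`, `v ↦ v · 1_ℳ`. -/
def toM : V →ₗ[ℚ] M := Ve0.mkQ

theorem toM_surjective : Function.Surjective toM := Submodule.mkQ_surjective Ve0

/-- The element `1_ℳ`, the class of `1`. -/
def oneM : M := toM 1

theorem der10_Ve0 (v : V) : Ve0 ≤ Ve0.comap (der10 v) := by
  intro x hx
  obtain ⟨a, rfl⟩ := (mem_Ve0 x).1 hx
  refine (mem_Ve0 _).2 ⟨der1 v a + a * v, ?_⟩
  rw [der10_apply, der1_mul, der1_e0, Ring.lie_def]
  noncomm_ring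

/-- The endomorphism `der_v^{ℳ,(10)}` of `ℳ` induced by `der_v^{𝒱,(10)}`; linear in `v`. -/
def der10M : V →ₗ[ℚ] (M →ₗ[ℚ] M) where
  toFun v := Ve0.mapQ Ve0 (der10 v) (der10_Ve0 v)
  map_add' v w := by
    refine LinearMap.ext fun m => ?_
    obtain ⟨a, rfl⟩ := toM_surjective m
    change toM (der10 (v + w) a) = toM (der10 v a) + toM (der10 w a)
    rw [← map_add, der10_apply, der10_apply, der10_apply, der1_add, LinearMap.add_apply, mul_add]
    congr 1
    abel
  map_smul' c v := by
    refine LinearMap.ext fun m => ?_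
    obtain ⟨a, rfl⟩ := toM_surjective m
    change toM (der10 (c • v) a) = c • toM (der10 v a)
    rw [← map_smul, der10_apply, der10_apply, der1_smul, LinearMap.smul_apply, mul_smul_comm,
      smul_add]

theorem der10M_toM (v a : V) : der10M v (toM a) = toM (der10 v a) := rfl

theorem word_mem_W (w : FreeMonoid (Fin 2)) (h : ¬ w.toList.getLast? = some 0) :
    wordBasis w ∈ W := by
  rcases List.eq_nil_or_concat' w.toList with hw | ⟨l, i, hw⟩
  · have : w = 1 := hw
    rw [this, wordBasis_one]
    exact one_mem W
  · rw [hw] at h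
    have hi : i = 1 := by
      have : i ≠ 0 := by simpa using h
      omega
    have : w = FreeMonoid.ofList l * FreeMonoid.of 1 := by rw [← hi]; exact hw
    rw [this, wordBasis_mul, wordBasis_of_one]
    exact mul_e1_mem _

/-- The projection `𝒱 = 𝒲 ⊕ 𝒱 e₀ → 𝒲`: it kills the words that end in `e₀` and
fixes all other words. -/
def projW : V →ₗ[ℚ] W :=
  wordBasis.constr ℚ fun w =>
    if h : w.toList.getLast? = some 0 then 0 else ⟨wordBasis w, word_mem_W w h⟩

theorem projW_mul_e0 (v : V) : projW (v * e0) = 0 := by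
  have h : projW ∘ₗ LinearMap.mulRight ℚ e0 = 0 := by
    refine wordBasis.ext fun w => ?_
    rw [LinearMap.comp_apply, LinearMap.mulRight_apply, ← wordBasis_of_zero, ← wordBasis_mul,
      projW, Module.Basis.constr_basis, dif_pos (by simp)]
    rfl
  exact DFunLike.congr_fun h v

theorem projW_mul_e1 (v : V) : projW (v * e1) = ⟨v * e1, mul_e1_mem v⟩ := by
  have h : W.val.toLinearMap ∘ₗ projW ∘ₗ LinearMap.mulRight ℚ e1 = LinearMap.mulRight ℚ e1 := by
    refine wordBasis.ext fun w => ?_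
    rw [LinearMap.comp_apply, LinearMap.comp_apply, LinearMap.mulRight_apply,
      ← wordBasis_of_one, ← wordBasis_mul, projW, Module.Basis.constr_basis, dif_neg (by simp)]
    rfl
  exact Subtype.ext (DFunLike.congr_fun h v)

theorem projW_coe (w : W) : projW (w : V) = w := by
  obtain ⟨_, c, v, rfl⟩ := w
  have h1 : projW (1 : V) = 1 := by
    rw [← wordBasis_one, projW, Module.Basis.constr_basis, dif_neg (by simp)]
    exact Subtype.ext wordBasis_one
  apply Subtype.ext
  simp only [map_add, projW_mul_e1, Algebra.algebraMap_eq_smul_one, map_smul, h1]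
  rfl

/-- The map `𝒲 → ℳ`, `w ↦ w · 1_ℳ`. -/
def WtoM : W →ₗ[ℚ] M := toM ∘ₗ W.val.toLinearMap

/-- The inverse `ℳ → 𝒲` of the bijection `w ↦ w · 1_ℳ`. -/
def MtoW : M →ₗ[ℚ] W :=
  Ve0.liftQ projW (by
    intro x hx
    obtain ⟨a, rfl⟩ := (mem_Ve0 x).1 hx
    exact projW_mul_e0 a)

theorem MtoW_WtoM (w : W) : MtoW (WtoM w) = w := projW_coe w

theorem WtoM_MtoW (m : M) : WtoM (MtoW m) = m := by
  have h : WtoM ∘ₗ projW = toM := by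
    refine wordBasis.ext fun w => ?_
    rw [LinearMap.comp_apply, projW, Module.Basis.constr_basis]
    split_ifs with h0
    · rcases List.eq_nil_or_concat' w.toList with hw | ⟨l, i, hw⟩
      · simp [hw] at h0
      · have hi : i = 0 := by rw [hw] at h0; simpa using h0
        have : w = FreeMonoid.ofList l * FreeMonoid.of 0 := by rw [← hi]; exact hw
        rw [this, wordBasis_mul, wordBasis_of_zero, map_zero]
        exact ((Submodule.Quotient.mk_eq_zero Ve0).2 ((mem_Ve0 _).2 ⟨_, rfl⟩)).symm
    · rfl
  obtain ⟨v, rfl⟩ := toM_surjective m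
  exact DFunLike.congr_fun h v

/-- The coproduct `Δ^ℳ : ℳ → ℳ ⊗ ℳ` with `Δ^ℳ(w · 1_ℳ) = Δ^𝒲(w) · (1_ℳ ⊗ 1_ℳ)`
for all `w` in `𝒲`. -/
def DeltaM : M →ₗ[ℚ] M ⊗[ℚ] M :=
  TensorProduct.map WtoM WtoM ∘ₗ DeltaW.toLinearMap ∘ₗ MtoW

theorem DeltaM_WtoM (w : W) : DeltaM (WtoM w) = TensorProduct.map WtoM WtoM (DeltaW w) := by
  simp [DeltaM, MtoW_WtoM]

/-- The space `𝒫(ℳ)` of the `m` with `Δ^ℳ(m) = m ⊗ 1_ℳ + 1_ℳ ⊗ m`. -/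
def primM : Submodule ℚ M :=
  LinearMap.ker
    (DeltaM - ((TensorProduct.mk ℚ M M).flip oneM + TensorProduct.mk ℚ M M oneM))

theorem mem_primM (m : M) : m ∈ primM ↔ DeltaM m = m ⊗ₜ[ℚ] oneM + oneM ⊗ₜ[ℚ] m := by
  simp [primM, sub_eq_zero]

/-! ## The action of `𝔩𝔦𝔢(e₀, e₁)` on `Hom(ℳ, ℳ ⊗ ℳ)` and the stabilizer -/

/-- For an endomorphism `D` of `ℳ`, the map `h ↦ (D ⊗ id + id ⊗ D) ∘ h - h ∘ D`. -/
def endAct (D : M →ₗ[ℚ] M) (h : M →ₗ[ℚ] M ⊗[ℚ] M) : M →ₗ[ℚ] M ⊗[ℚ] M :=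
  (TensorProduct.map D LinearMap.id + TensorProduct.map LinearMap.id D) ∘ₗ h - h ∘ₗ D

/-- The action `v * h` of `v ∈ 𝔩𝔦𝔢(e₀, e₁)` on `h ∈ Hom(ℳ, ℳ ⊗ ℳ)`, through the endomorphism
`der_{θ(v)}^{ℳ,(10)}` of `ℳ`. -/
def lieAct (v : lie) (h : M →ₗ[ℚ] M ⊗[ℚ] M) : M →ₗ[ℚ] M ⊗[ℚ] M :=
  endAct (der10M (theta v)) h

/-- The stabilizer `{v ∈ 𝔩𝔦𝔢(e₀, e₁) | v * h = 0}` of `h ∈ Hom(ℳ, ℳ ⊗ ℳ)`. -/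
def stabLie (h : M →ₗ[ℚ] M ⊗[ℚ] M) : Submodule ℚ lie where
  carrier := {v | lieAct v h = 0}
  zero_mem' := by
    simp [lieAct, endAct]
  add_mem' := by
    intro v w hv hw
    have : lieAct (v + w) h = lieAct v h + lieAct w h := by
      simp only [lieAct, endAct, map_add, TensorProduct.map_add_left,
        TensorProduct.map_add_right, LinearMap.add_comp, LinearMap.comp_add]
      abel
    simp only [Set.mem_ofPred_eq] at hv hw ⊢
    rw [this, hv, hw, add_zero]
  smul_mem' := by
    intro c v hv
    have : lieAct (c • v) h = c • lieAct v h := by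
      simp only [lieAct, endAct, map_smul, TensorProduct.map_smul_left,
        TensorProduct.map_smul_right, LinearMap.smul_comp, LinearMap.comp_smul,
        LinearMap.add_comp, smul_sub, smul_add]
    simp only [Set.mem_ofPred_eq] at hv ⊢
    rw [this, hv, smul_zero]

theorem mem_stabLie (h : M →ₗ[ℚ] M ⊗[ℚ] M) (v : lie) : v ∈ stabLie h ↔ lieAct v h = 0 := Iff.rfl

end

end HarmCoprod

open scoped TensorProduct

namespace HarmCoprod

noncomputable section

attribute [local instance] LieRing.ofAssociativeRing

/-! ## Words and coefficients -/

/-! Identify `ℳ` with `𝒲` and put v = θ(x), p = `projW v`. Then `D_x` becomes `derW v` plus right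
multiplication by p, and x stabilizes the coproduct iff this map is a coderivation of `𝒲`.
Evaluation at 1 forces p to be primitive. Once p is primitive, right multiplication by p contributes
exactly right multiplication by Δ(p), so the condition becomes that the derivation `derW v` is a
coderivation (`der10W_coderivation_iff`). It remains to see that, for p primitive, this happens iff
x[2] = 0.

Two features of v make `derW v` computable. First, v is killed by ∂₀, hence v = ∑ pₖ e₀ᵏ with pₖ =
(-∂₀)ᵏ(p)/k! (`eq_sum_taylor`). Second, up to its polynomial part in e₁, v is negated by the
antipode. Together they give `derW_theta_yInt`: for n ≥ 1, der(ỹₙ) + ỹₙ Q(ỹ₁) = F(n), where Q is the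
even polynomial `evenPart (thetaPoly x)`. Since the pₖ and their images under T = `signRev` are
primitive, Δ(F(n)) = -∑ (F(n-b) ⊗ ỹ_b + ỹ_b ⊗ F(n-b)) for every integer n (`DeltaW_F`). This is the
coderivation identity, provided that Q = 0 and that F vanishes at all n ≤ 0.

As der(ỹ₁) = 0, F(1) = ỹ₁ Q(ỹ₁). Comparing coefficients in Δ(F(1)) kills every coefficient of Q
except that of X², which is (x|e₀e₁) and vanishes iff x[2] = 0. If it vanishes, then F(1) = 0, and
Δ(F(1)) = 0 gives F(n) = 0 for n ≤ 0 (`F_nonpos_eq_zero`). Conversely, for a coderivation, comparing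
Δ(F(1)) with Δ(F(2)) gives 3q = q for that coefficient q (`evenPart_coeff_two_eq_zero`). -/

theorem V_word_induction {P : V → Prop} (hadd : ∀ a b, P a → P b → P (a + b))
    (hsmul : ∀ (c : ℚ) a, P a → P (c • a)) (h1 : P 1) (he0 : ∀ a, P a → P (e0 * a))
    (he1 : ∀ a, P a → P (e1 * a)) (v : V) : P v := by
  have hw : ∀ w : FreeMonoid (Fin 2), P (wordBasis w) := by
    intro w
    induction w using FreeMonoid.recOn with
    | one => rwa [wordBasis_one]
    | of_mul i w hw =>
      rw [wordBasis_mul]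
      fin_cases i
      · exact wordBasis_of_zero ▸ he0 _ hw
      · exact wordBasis_of_one ▸ he1 _ hw
  have hv : v ∈ Submodule.span ℚ (Set.range wordBasis) := by simp [wordBasis.span_eq]
  induction hv using Submodule.span_induction with
  | mem x h => obtain ⟨w, rfl⟩ := h; exact hw w
  | zero => simpa using hsmul 0 1 h1
  | add x y _ _ hx hy => exact hadd x y hx hy
  | smul c x _ hx => exact hsmul c x hx

open scoped Classical in
theorem coeff_wordBasis (w w' : FreeMonoid (Fin 2)) :
    coeff w (wordBasis w') = if w' = w then 1 else 0 := by
  simp [coeff, Finsupp.single_apply]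

theorem eq_zero_of_coeff (x : V) (h : ∀ w, coeff w x = 0) : x = 0 :=
  wordBasis.ext_elem fun w => by simpa [coeff] using h w

theorem coeff_of_mul_wordBasis_mul (i j : Fin 2) (w : FreeMonoid (Fin 2)) (a : V) :
    coeff (FreeMonoid.of i * w) (wordBasis (FreeMonoid.of j) * a) =
      if j = i then coeff w a else 0 := by
  have h : coeff (FreeMonoid.of i * w) ∘ₗ LinearMap.mulLeft ℚ (wordBasis (FreeMonoid.of j)) =
      if j = i then coeff w else 0 := by
    refine wordBasis.ext fun w' => ?_
    rw [LinearMap.comp_apply, LinearMap.mulLeft_apply, ← wordBasis_mul, coeff_wordBasis]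
    have : FreeMonoid.of j * w' = FreeMonoid.of i * w ↔ j = i ∧ w' = w := by
      constructor
      · intro h
        have := congrArg FreeMonoid.toList h
        simpa using this
      · rintro ⟨rfl, rfl⟩; rfl
    by_cases hj : j = i
    · by_cases hw : w' = w
      · rw [if_pos (this.2 ⟨hj, hw⟩), if_pos hj, coeff_wordBasis, if_pos hw]
      · rw [if_neg fun h => hw (this.1 h).2, if_pos hj, coeff_wordBasis, if_neg hw]
    · rw [if_neg fun h => hj (this.1 h).1, if_neg hj, LinearMap.zero_apply]
  have := DFunLike.congr_fun h a
  rw [LinearMap.comp_apply, LinearMap.mulLeft_apply] at this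
  rw [this]; split_ifs <;> rfl

theorem coeff_one_wordBasis_mul (j : Fin 2) (a : V) :
    coeff 1 (wordBasis (FreeMonoid.of j) * a) = 0 := by
  have h : coeff 1 ∘ₗ LinearMap.mulLeft ℚ (wordBasis (FreeMonoid.of j)) = 0 := by
    refine wordBasis.ext fun w' => ?_
    rw [LinearMap.comp_apply, LinearMap.mulLeft_apply, ← wordBasis_mul, coeff_wordBasis, if_neg]
    · rfl
    · intro h
      have := congrArg FreeMonoid.toList h
      simp at this
  exact DFunLike.congr_fun h a

/-- The augmentation of `𝒱`. -/
def aug : V →ₐ[ℚ] ℚ := FreeAlgebra.lift ℚ fun _ => 0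

theorem aug_e0 : aug e0 = 0 := by simp [aug, e0]

theorem aug_e1 : aug e1 = 0 := by simp [aug, e1]

theorem coeff_one (a : V) : coeff 1 a = aug a := by
  induction a using V_word_induction with
  | hadd a b ha hb => simp [ha, hb]
  | hsmul c a ha => simp [ha]
  | h1 => rw [← wordBasis_one, coeff_wordBasis, wordBasis_one]; simp
  | he0 a _ => rw [← wordBasis_of_zero, coeff_one_wordBasis_mul, wordBasis_of_zero]; simp [aug_e0]
  | he1 a _ => rw [← wordBasis_of_one, coeff_one_wordBasis_mul, wordBasis_of_one]; simp [aug_e1]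

theorem word01_succ (n : ℕ) : word01 (n + 1) = FreeMonoid.of 0 * word01 n := by
  rw [word01, pow_succ', mul_assoc, word01]

theorem coeff_word01_e1_mul (n : ℕ) (a : V) :
    coeff (word01 n) (e1 * a) = if n = 0 then aug a else 0 := by
  cases n with
  | zero =>
    have : word01 0 = FreeMonoid.of 1 * 1 := by simp [word01]
    rw [this, ← wordBasis_of_one, coeff_of_mul_wordBasis_mul, coeff_one]; simp
  | succ n => rw [word01_succ, ← wordBasis_of_one, coeff_of_mul_wordBasis_mul]; simp

theorem coeff_word01_e0_mul (n : ℕ) (a : V) :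
    coeff (word01 (n + 1)) (e0 * a) = coeff (word01 n) a := by
  rw [word01_succ, ← wordBasis_of_zero, coeff_of_mul_wordBasis_mul]; simp

theorem coeff_word01_zero_e0_mul (a : V) : coeff (word01 0) (e0 * a) = 0 := by
  have : word01 0 = FreeMonoid.of 1 * 1 := by simp [word01]
  rw [this, ← wordBasis_of_zero, coeff_of_mul_wordBasis_mul]; simp

theorem coeff_word01_one (n : ℕ) : coeff (word01 n) 1 = 0 := by
  rw [← wordBasis_one, coeff_wordBasis, if_neg]
  intro h
  have := congrArg FreeMonoid.toList h
  simp [word01] at this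

theorem coeff_word01_pow_mul (n m : ℕ) (a : V) :
    coeff (word01 n) (e0 ^ m * e1 * a) = if n = m then aug a else 0 := by
  induction m generalizing n with
  | zero => simpa using coeff_word01_e1_mul n a
  | succ m ih =>
    rw [pow_succ', mul_assoc, mul_assoc, ← mul_assoc (e0 ^ m)]
    cases n with
    | zero => rw [coeff_word01_zero_e0_mul]; simp
    | succ n => rw [coeff_word01_e0_mul, ih]; simp

theorem coeff_word01_mul_e0 (n : ℕ) (a : V) : coeff (word01 n) (a * e0) = 0 := by
  have h : coeff (word01 n) ∘ₗ LinearMap.mulRight ℚ e0 = 0 := by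
    refine wordBasis.ext fun w' => ?_
    rw [LinearMap.comp_apply, LinearMap.mulRight_apply, ← wordBasis_of_zero, ← wordBasis_mul,
      coeff_wordBasis, if_neg]
    · rfl
    · intro h
      have := congrArg (fun l => (FreeMonoid.toList l).getLast?) h
      simp [word01] at this
  exact DFunLike.congr_fun h a

/-! ## The derivation `∂₀` and the antipode of `𝒱` -/

/-- The algebra morphism `a ↦ (a, ∂₀ a)`. -/
def partialHom : V →ₐ[ℚ] TrivSqZeroExt V V :=
  FreeAlgebra.lift ℚ fun i : Fin 2 =>
    if i = 0 then TrivSqZeroExt.inl e0 + TrivSqZeroExt.inr 1 else TrivSqZeroExt.inl e1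

theorem partialHom_fst (a : V) : (partialHom a).fst = a := by
  have h : (TrivSqZeroExt.fstHom ℚ V V).comp partialHom = AlgHom.id ℚ V := by
    apply FreeAlgebra.hom_ext
    funext i
    fin_cases i <;> simp [partialHom, e0, e1]
  exact DFunLike.congr_fun h a

/-- The derivation `∂₀` of `𝒱` with `e₀ ↦ 1` and `e₁ ↦ 0`. -/
def partial0 : V →ₗ[ℚ] V where
  toFun a := (partialHom a).snd
  map_add' a b := by simp
  map_smul' c a := by simp

theorem partial0_mul (a b : V) : partial0 (a * b) = partial0 a * b + a * partial0 b := by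
  simp [partial0, partialHom_fst, add_comm]

theorem partial0_e0 : partial0 e0 = 1 := by simp [partial0, partialHom, e0]

theorem partial0_e1 : partial0 e1 = 0 := by simp [partial0, partialHom, e1]

theorem partial0_one : partial0 1 = 0 := by simp [partial0]

theorem partial0_algebraMap (c : ℚ) : partial0 (algebraMap ℚ V c) = 0 := by
  simp [partial0, TrivSqZeroExt.algebraMap_eq_inl']

theorem partial0_e0_pow (n : ℕ) : partial0 (e0 ^ (n + 1)) = ((n : ℚ) + 1) • e0 ^ n := by
  induction n with
  | zero => simp [partial0_e0]
  | succ n ih =>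
    rw [pow_succ, partial0_mul, ih, partial0_e0, mul_one, smul_mul_assoc, ← pow_succ]
    push_cast
    module

theorem partial0_e1_pow (n : ℕ) : partial0 (e1 ^ n) = 0 := by
  induction n with
  | zero => simp [partial0_one]
  | succ n ih => rw [pow_succ, partial0_mul, ih, partial0_e1]; simp

/-- ∂₀² kills both letters, so the Leibniz formula for ∂₀ⁿ(letter · a) has only two terms, and each
additional letter raises the nilpotency bound by at most one. -/
theorem partial0_nilpotent (v : V) : ∃ N, ∀ n, N ≤ n → (partial0 ^ n) v = 0 := by
  have hs : ∀ (i : V), partial0 (partial0 i) = 0 → ∀ (n : ℕ) (a : V),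
      (partial0 ^ (n + 1)) (i * a) =
        i * (partial0 ^ (n + 1)) a + ((n : ℚ) + 1) • (partial0 i * (partial0 ^ n) a) := by
    intro i hi n a
    induction n with
    | zero => simp [partial0_mul, add_comm]
    | succ n ih =>
      have h1 := fun k => (congrArg (· a) (pow_succ' partial0 k)).trans
        (Module.End.mul_apply partial0 (partial0 ^ k) a)
      rw [pow_succ', Module.End.mul_apply, ih, map_add, map_smul, partial0_mul, partial0_mul, hi,
        Module.End.mul_apply partial0 (partial0 ^ (n + 1)) a, h1 n, zero_mul, zero_add]
      push_cast
      module
  induction v using V_word_induction with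
  | hadd a b ha hb =>
    obtain ⟨N, hN⟩ := ha
    obtain ⟨N', hN'⟩ := hb
    exact ⟨max N N', fun n hn => by
      rw [map_add, hN n (le_trans (le_max_left _ _) hn), hN' n (le_trans (le_max_right _ _) hn),
        add_zero]⟩
  | hsmul c a ha => exact ha.imp fun N hN n hn => by rw [map_smul, hN n hn, smul_zero]
  | h1 =>
    refine ⟨1, fun n hn => ?_⟩
    obtain ⟨m, rfl⟩ := Nat.exists_eq_add_of_le' hn
    rw [pow_succ, Module.End.mul_apply, partial0_one, map_zero]
  | he0 a ha =>
    obtain ⟨N, hN⟩ := ha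
    refine ⟨N + 1, fun n hn => ?_⟩
    obtain ⟨m, rfl⟩ := Nat.exists_eq_add_of_le' (le_trans (Nat.le_add_left 1 N) hn)
    rw [hs e0 (by simp [partial0_e0, partial0_one]), hN _ (by omega), hN _ (by omega)]
    simp
  | he1 a ha =>
    obtain ⟨N, hN⟩ := ha
    refine ⟨N + 1, fun n hn => ?_⟩
    obtain ⟨m, rfl⟩ := Nat.exists_eq_add_of_le' (le_trans (Nat.le_add_left 1 N) hn)
    rw [hs e1 (by simp [partial0_e1]), hN _ (by omega), hN _ (by omega)]
    simp

/-- Repeated differentiation of the hypothesis gives ∂₀ⁿ⁺¹(a) e₀ + (n+1) ∂₀ⁿ(a) = 0. Nilpotency of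
∂₀ at a then allows a descent from high powers of ∂₀ to a itself. -/
theorem eq_zero_of_partial0_mul_e0 (a : V) (h : partial0 (a * e0) = 0) : a = 0 := by
  have key : ∀ n : ℕ, (partial0 ^ (n + 1)) a * e0 + ((n : ℚ) + 1) • (partial0 ^ n) a = 0 := by
    intro n
    induction n with
    | zero => simpa [partial0_mul, partial0_e0] using h
    | succ n ih =>
      have := congrArg partial0 ih
      rw [map_add, map_smul, partial0_mul, partial0_e0, map_zero, mul_one,
        ← Module.End.mul_apply, ← pow_succ', ← Module.End.mul_apply, ← pow_succ'] at this
      rw [← this]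
      push_cast
      module
  obtain ⟨N, hN⟩ := partial0_nilpotent a
  have hd : ∀ k, k ≤ N → (partial0 ^ (N - k)) a = 0 := by
    intro k
    induction k with
    | zero => intro _; exact hN _ (by simp)
    | succ k ih =>
      intro hk
      have h1 := key (N - (k + 1))
      rw [show N - (k + 1) + 1 = N - k by omega, ih (by omega), zero_mul, zero_add] at h1
      exact (smul_eq_zero.1 h1).resolve_left (by positivity)
  simpa using hd N le_rfl

/-- The antipode of `𝒱`: the antiautomorphism with `e₀ ↦ -e₀` and `e₁ ↦ -e₁`. -/
def antipodeV : V →ₗ[ℚ] V :=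
  (MulOpposite.opLinearEquiv ℚ).symm.toLinearMap ∘ₗ
    (FreeAlgebra.lift ℚ fun i : Fin 2 => MulOpposite.op (-FreeAlgebra.ι ℚ i : V)).toLinearMap

theorem antipodeV_mul (a b : V) : antipodeV (a * b) = antipodeV b * antipodeV a := by
  simp [antipodeV]

theorem antipodeV_one : antipodeV 1 = 1 := by simp [antipodeV]

theorem antipodeV_e0 : antipodeV e0 = -e0 := by simp [antipodeV, e0]

theorem antipodeV_e1 : antipodeV e1 = -e1 := by simp [antipodeV, e1]

theorem antipodeV_e0_pow (n : ℕ) : antipodeV (e0 ^ n) = (-1 : ℚ) ^ n • e0 ^ n := by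
  induction n with
  | zero => simp [antipodeV_one]
  | succ n ih =>
    rw [pow_succ, antipodeV_mul, ih, antipodeV_e0, ← pow_succ, pow_succ', pow_succ']
    simp

/-! ## Properties of Lie elements -/

theorem antipodeV_lie (x : lie) : antipodeV (x : V) = -x := by
  obtain ⟨x, hx⟩ := x
  change antipodeV x = -x
  induction hx using LieSubalgebra.lieSpan_induction with
  | mem x h =>
    rcases h with rfl | rfl
    · exact antipodeV_e0
    · exact antipodeV_e1
  | zero => simp
  | smul c x _ hx => rw [map_smul, hx, smul_neg]
  | add x y _ _ hx hy => rw [map_add, hx, hy, neg_add]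
  | lie x y _ _ hx hy =>
    rw [Ring.lie_def, map_sub, antipodeV_mul, antipodeV_mul, hx, hy]
    noncomm_ring

theorem coeff_of_zero_eq (a : V) : coeff (FreeMonoid.of 0) a = aug (partial0 a) := by
  rw [← mul_one (FreeMonoid.of (0 : Fin 2))]
  induction a using V_word_induction with
  | hadd a b ha hb => rw [map_add, ha, hb, map_add, map_add]
  | hsmul c a ha => rw [map_smul, ha, map_smul, map_smul]
  | h1 =>
    rw [partial0_one, ← wordBasis_one, coeff_wordBasis, if_neg]
    · simp
    · intro h
      have := congrArg FreeMonoid.toList h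
      simp at this
  | he0 a _ =>
    rw [← wordBasis_of_zero, coeff_of_mul_wordBasis_mul, wordBasis_of_zero, partial0_mul]
    simp [partial0_e0, aug_e0, coeff_one]
  | he1 a _ =>
    rw [← wordBasis_of_one, coeff_of_mul_wordBasis_mul, wordBasis_of_one, partial0_mul]
    simp [partial0_e1, aug_e1]

/-- A derivation with scalar values on the generators kills every bracket, because scalars are
central. Only the linear part in e₀ contributes. -/
theorem partial0_lie (x : lie) :
    partial0 (x : V) = algebraMap ℚ V (coeff (FreeMonoid.of 0) (x : V)) := by
  obtain ⟨x, hx⟩ := x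
  have h : ∃ c, partial0 x = algebraMap ℚ V c := by
    induction hx using LieSubalgebra.lieSpan_induction with
    | mem x h =>
      rcases h with rfl | rfl
      · exact ⟨1, by simp [partial0_e0]⟩
      · exact ⟨0, by simp [partial0_e1]⟩
    | zero => exact ⟨0, by simp⟩
    | smul c x _ hx =>
      obtain ⟨d, hd⟩ := hx
      exact ⟨c * d, by rw [map_smul, hd, map_mul, Algebra.smul_def]⟩
    | add x y _ _ hx hy =>
      obtain ⟨c, hc⟩ := hx
      obtain ⟨d, hd⟩ := hy
      exact ⟨c + d, by rw [map_add, hc, hd, map_add]⟩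
    | lie x y _ _ hx hy =>
      obtain ⟨c, hc⟩ := hx
      obtain ⟨d, hd⟩ := hy
      refine ⟨0, ?_⟩
      rw [Ring.lie_def, map_sub, partial0_mul, partial0_mul, hc, hd, Algebra.commutes c,
        Algebra.commutes d, map_zero]
      abel
  obtain ⟨c, hc⟩ := h
  change partial0 x = algebraMap ℚ V (coeff _ x)
  rw [coeff_of_zero_eq, hc]
  simp

theorem aug_lie (x : lie) : aug (x : V) = 0 := by
  obtain ⟨x, hx⟩ := x
  change aug x = 0
  induction hx using LieSubalgebra.lieSpan_induction with
  | mem x h =>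
    rcases h with rfl | rfl
    · exact aug_e0
    · exact aug_e1
  | zero => simp
  | smul c x _ hx => rw [map_smul, hx, smul_zero]
  | add x y _ _ hx hy => rw [map_add, hx, hy, add_zero]
  | lie x y _ _ hx hy => rw [Ring.lie_def, map_sub, map_mul, map_mul, hx, hy]; simp

theorem degComp_eq_zero_iff (d : ℕ) (x : V) :
    degComp d x = 0 ↔ ∀ w : FreeMonoid (Fin 2), w.length = d → coeff w x = 0 := by
  have h : ∀ w, coeff w (degComp d x) = if w.length = d then coeff w x else 0 := by
    intro w
    have : coeff w ∘ₗ degComp d = if w.length = d then coeff w else 0 := by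
      refine wordBasis.ext fun w' => ?_
      rw [LinearMap.comp_apply, degComp, Module.Basis.constr_basis]
      by_cases hw : w' = w
      · subst hw; split_ifs <;> simp
      · split_ifs <;> simp [coeff_wordBasis, hw]
    have := DFunLike.congr_fun this x
    rw [LinearMap.comp_apply] at this
    rw [this]; split_ifs <;> rfl
  constructor
  · intro h0 w hw
    have := h w
    rw [h0, map_zero, if_pos hw] at this
    exact this.symm
  · intro h0
    refine eq_zero_of_coeff _ fun w => ?_
    rw [h]
    split_ifs with hw
    · exact h0 w hw
    · rfl

theorem antipodeV_wordBasis (w : FreeMonoid (Fin 2)) :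
    antipodeV (wordBasis w) = (-1 : ℚ) ^ w.length • wordBasis w.reverse := by
  induction w using FreeMonoid.recOn with
  | one =>
    have : FreeMonoid.reverse (1 : FreeMonoid (Fin 2)) = 1 := rfl
    simp [this, wordBasis_one, antipodeV_one]
  | of_mul i w hw =>
    have h : antipodeV (wordBasis (FreeMonoid.of i)) = -wordBasis (FreeMonoid.of i) := by
      fin_cases i
      · exact wordBasis_of_zero ▸ antipodeV_e0
      · exact wordBasis_of_one ▸ antipodeV_e1
    have hr : (FreeMonoid.of i * w).reverse = w.reverse * FreeMonoid.of i := by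
      rw [FreeMonoid.reverse_mul]; rfl
    rw [wordBasis_mul, antipodeV_mul, hw, h, hr, wordBasis_mul, FreeMonoid.length_mul,
      FreeMonoid.length_of, pow_add]
    simp

theorem coeff_antipodeV (w : FreeMonoid (Fin 2)) (x : V) :
    coeff w (antipodeV x) = (-1 : ℚ) ^ w.length * coeff w.reverse x := by
  have h : coeff w ∘ₗ antipodeV = (-1 : ℚ) ^ w.length • coeff w.reverse := by
    refine wordBasis.ext fun w' => ?_
    have hr : w'.reverse = w ↔ w' = w.reverse :=
      ⟨fun h => by rw [← h, FreeMonoid.reverse_reverse],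
        fun h => by rw [h, FreeMonoid.reverse_reverse]⟩
    rw [LinearMap.comp_apply, antipodeV_wordBasis, map_smul, LinearMap.smul_apply,
      coeff_wordBasis, coeff_wordBasis]
    by_cases hw : w' = w.reverse
    · rw [if_pos hw, if_pos (hr.2 hw), hw, FreeMonoid.length_reverse]
    · rw [if_neg hw, if_neg (mt hr.1 hw)]; simp
  simpa using DFunLike.congr_fun h x

/-- The component of degree `2` of a Lie element is a multiple of `[e₀, e₁]`. -/
theorem degComp_two_lie_eq_zero_iff (x : lie) :
    degComp 2 (x : V) = 0 ↔ coeff (word01 1) (x : V) = 0 := by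
  have hlen : (word01 1).length = 2 := by simp [word01]
  rw [degComp_eq_zero_iff]
  refine ⟨fun h => h _ hlen, fun h w hw => ?_⟩
  -- In even length the antipode reverses words without a sign, so Lie elements have antisymmetric
  -- coefficients: e₀e₀ and e₁e₁ drop out, and e₁e₀ is tied to e₀e₁.
  have hS : coeff w.reverse (x : V) = -coeff w (x : V) := by
    have := coeff_antipodeV w (x : V)
    rw [antipodeV_lie, hw, map_neg] at this
    linarith
  obtain ⟨i, j, rfl⟩ : ∃ i j, w = FreeMonoid.of i * FreeMonoid.of j := by
    obtain ⟨i, j, h⟩ := List.length_eq_two.1 (show w.toList.length = 2 from hw)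
    exact ⟨i, j, h⟩
  have hrev : (FreeMonoid.of i * FreeMonoid.of j).reverse = FreeMonoid.of j * FreeMonoid.of i :=
    rfl
  rw [hrev] at hS
  have h01 : word01 1 = FreeMonoid.of 0 * FreeMonoid.of 1 := by simp [word01]
  rw [h01] at h
  fin_cases i <;> fin_cases j <;> simp only [Fin.zero_eta, Fin.mk_one, Fin.isValue] at hS ⊢ <;>
    linarith

/-! ## The algebra `𝒲`: induction, the elements `ỹₙ` and linear forms -/

theorem W_induction {P : W → Prop} (hadd : ∀ a b, P a → P b → P (a + b))
    (hmul : ∀ a b, P a → P b → P (a * b)) (hsmul : ∀ (c : ℚ) a, P a → P (c • a)) (h1 : P 1)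
    (hy : ∀ n, P (yTilde (n + 1))) (w : W) : P w := by
  -- The prefix e₀ⁿ accumulates letters e₀ until the next e₁ completes a generator.
  have key : ∀ (v : V) (n : ℕ), P ⟨e0 ^ n * v * e1, mul_e1_mem _⟩ := by
    intro v
    induction v using V_word_induction with
    | hadd a b ha hb =>
      intro n
      convert hadd _ _ (ha n) (hb n) using 1
      exact Subtype.ext (by simp [mul_add, add_mul])
    | hsmul c a ha =>
      intro n
      convert hsmul c _ (ha n) using 1
      exact Subtype.ext (by simp)
    | h1 =>
      intro n
      convert hy n using 1
      exact Subtype.ext (by simp [yTilde])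
    | he0 a ha =>
      intro n
      convert ha (n + 1) using 1
      exact Subtype.ext (by simp [pow_succ, mul_assoc])
    | he1 a ha =>
      intro n
      convert hmul _ _ (hy n) (ha 0) using 1
      exact Subtype.ext (by simp [yTilde, mul_assoc])
  obtain ⟨_, c, v, rfl⟩ := w
  convert hadd _ _ (hsmul c 1 h1) (key v 0) using 1
  exact Subtype.ext (by simp [Algebra.algebraMap_eq_smul_one])

/-- The elements `ỹₙ`, extended by `0` to negative indices. -/
def yInt (n : ℤ) : W := if n < 0 then 0 else yTilde n.toNat

theorem yInt_of_neg {n : ℤ} (h : n < 0) : yInt n = 0 := if_pos h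

theorem yInt_natCast (n : ℕ) : yInt n = yTilde n := by simp [yInt]

theorem yInt_zero : yInt 0 = -1 := by simp [yInt, yTilde]

theorem yInt_succ (n : ℕ) : yInt (n + 1) = yTilde (n + 1) := by
  rw [← yInt_natCast]; push_cast; rfl

theorem coe_yInt_succ (n : ℕ) : (yInt (n + 1) : V) = e0 ^ n * e1 := by
  rw [yInt_succ]; rfl

/-- Statements on `ỹₙ` for integers `n` reduce to `n < 0`, `n = 0`, and `n > 0`. -/
theorem yInt_cases {P : ℤ → Prop} (hneg : ∀ n < 0, P n) (h0 : P 0) (hpos : ∀ n : ℕ, P (n + 1))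
    (n : ℤ) : P n := by
  rcases lt_trichotomy n 0 with h | rfl | h
  · exact hneg n h
  · exact h0
  · obtain ⟨m, rfl⟩ : ∃ m : ℕ, n = m + 1 := ⟨(n - 1).toNat, by omega⟩
    exact hpos m

/-- The conventions ỹ₀ = -1 and ỹₙ = 0 for n < 0 make the formula uniform in n, and terms beyond n
vanish. An arbitrary bound B lets sums for different n share one index set. -/
theorem DeltaW_yInt (n : ℤ) (B : ℕ) (hB : n < B) :
    DeltaW (yInt n) = (-1 : ℚ) • ∑ b ∈ Finset.range B, yInt b ⊗ₜ[ℚ] yInt (n - b) := by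
  rcases lt_or_ge n 0 with h | h
  · rw [yInt_of_neg h, map_zero, Finset.sum_eq_zero, smul_zero]
    intro b _
    rw [yInt_of_neg (n := n - b) (by omega), TensorProduct.tmul_zero]
  · lift n to ℕ using h
    have hsub : Finset.range (n + 1) ⊆ Finset.range B :=
      Finset.range_subset_range.2 (by exact_mod_cast hB)
    rw [← Finset.sum_subset hsub]
    · rcases Nat.eq_zero_or_pos n with rfl | hn
      · have h : (-1 : W) = (-1 : ℚ) • 1 := by simp
        simp only [Nat.cast_zero, yInt_zero, zero_add, Finset.sum_range_one, sub_self]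
        rw [h, map_smul, map_one, Algebra.TensorProduct.one_def, TensorProduct.tmul_smul,
          TensorProduct.smul_tmul', smul_smul (-1 : ℚ) (-1 : ℚ)]
        norm_num
      · rw [yInt_natCast, DeltaW_yTilde n hn]
        refine (neg_one_smul ℚ (_ : W ⊗[ℚ] W)).symm.trans ?_
        congr 1
        refine Finset.sum_congr rfl fun b hb => ?_
        rw [yInt_natCast, ← Nat.cast_sub (by simpa [Nat.lt_succ_iff] using hb), yInt_natCast]
    · intro b _ hb
      rw [yInt_of_neg (n := (n : ℤ) - b) (by simp at hb; omega), TensorProduct.tmul_zero]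

theorem DeltaW_yInt' (n : ℤ) (B : ℕ) (hB : n < B) :
    DeltaW (yInt n) = (-1 : ℚ) • ∑ b ∈ Finset.range B, yInt (n - b) ⊗ₜ[ℚ] yInt b := by
  rcases lt_or_ge n 0 with h | h
  · rw [yInt_of_neg h, map_zero, Finset.sum_eq_zero, smul_zero]
    intro b _
    rw [yInt_of_neg (n := n - b) (by omega), TensorProduct.zero_tmul]
  · lift n to ℕ using h
    have hsub : Finset.range (n + 1) ⊆ Finset.range B :=
      Finset.range_subset_range.2 (by exact_mod_cast hB)
    rw [← Finset.sum_subset hsub, DeltaW_yInt n (n + 1) (by push_cast; omega)]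
    · congr 1
      rw [← Finset.sum_range_reflect]
      refine Finset.sum_congr rfl fun b hb => ?_
      have hb' : b ≤ n := by simpa [Nat.lt_succ_iff] using hb
      have h1 : ((n + 1 - 1 - b : ℕ) : ℤ) = n - b := by omega
      rw [h1, sub_sub_cancel]
    · intro b _ hb
      rw [yInt_of_neg (n := (n : ℤ) - b) (by simp at hb; omega), TensorProduct.zero_tmul]

/-- The augmentation of `𝒲`. -/
def augW : W →ₐ[ℚ] ℚ := aug.comp W.val

theorem augW_yInt (n : ℤ) (hn : n ≠ 0) : augW (yInt n) = 0 := by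
  induction n using yInt_cases with
  | hneg n h => rw [yInt_of_neg h, map_zero]
  | h0 => exact absurd rfl hn
  | hpos n =>
    change aug (yInt (n + 1) : V) = 0
    rw [coe_yInt_succ, map_mul, aug_e1, mul_zero]

/-- The coefficient of `ỹₙ₊₁` in elements of `𝒲`. -/
def depthOne (n : ℕ) : W →ₗ[ℚ] ℚ := coeff (word01 n) ∘ₗ W.val.toLinearMap

theorem depthOne_apply (n : ℕ) (w : W) : depthOne n w = coeff (word01 n) (w : V) := rfl

theorem depthOne_one (n : ℕ) : depthOne n 1 = 0 := coeff_word01_one n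

theorem depthOne_yInt (n : ℕ) (m : ℤ) : depthOne n (yInt m) = if m = n + 1 then 1 else 0 := by
  induction m using yInt_cases with
  | hneg m h => rw [yInt_of_neg h, map_zero, if_neg (by omega)]
  | h0 => rw [yInt_zero, map_neg, depthOne_one, neg_zero, if_neg (by omega)]
  | hpos m =>
    rw [depthOne_apply, coe_yInt_succ, ← mul_one (e0 ^ m * e1), coeff_word01_pow_mul, map_one]
    by_cases h : n = m
    · subst h; simp
    · rw [if_neg h, if_neg (by omega)]

/-- In terms of the free generators, a product of two elements without constant term has no part
linear in the ỹₙ. -/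
theorem depthOne_mul (n : ℕ) (w w' : W) :
    depthOne n (w * w') = depthOne n w * augW w' + augW w * depthOne n w' := by
  induction w using W_induction generalizing w' with
  | hadd a b ha hb => rw [add_mul, map_add, ha, hb, map_add, map_add]; ring
  | hmul a b ha hb => rw [mul_assoc, ha, hb, ha, map_mul, map_mul]; ring
  | hsmul c a ha =>
    rw [smul_mul_assoc, map_smul, ha, map_smul, map_smul, smul_eq_mul, smul_eq_mul, smul_eq_mul]
    ring
  | h1 => rw [one_mul, depthOne_one, map_one]; ring
  | hy m =>
    rw [← yInt_succ, augW_yInt _ (by omega), depthOne_yInt, depthOne_apply,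
      MulMemClass.coe_mul, coe_yInt_succ, coeff_word01_pow_mul, zero_mul, add_zero]
    by_cases h : n = m
    · subst h; simp; rfl
    · rw [if_neg h, if_neg (by omega), zero_mul]

/-- The algebra morphism `𝒲 → ℚ[X]` with `e₀ ↦ 0` and `e₁ ↦ X`. -/
def pureHom : W →ₐ[ℚ] Polynomial ℚ :=
  (FreeAlgebra.lift ℚ fun i : Fin 2 => if i = 0 then 0 else Polynomial.X).comp W.val

/-- The coefficient of `e₁ⁿ` in elements of `𝒲`. -/
def pureCoeff (n : ℕ) : W →ₗ[ℚ] ℚ := Polynomial.lcoeff ℚ n ∘ₗ pureHom.toLinearMap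

theorem pureCoeff_apply (n : ℕ) (w : W) : pureCoeff n w = (pureHom w).coeff n := rfl

/-- The element `e₁` of `𝒲`. -/
abbrev y1 : W := yInt 1

theorem coe_y1 : (y1 : V) = e1 := by
  have := coe_yInt_succ 0
  simpa using this

theorem pureHom_y1 : pureHom y1 = Polynomial.X := by
  simp [pureHom, coe_y1, e1]

theorem pureHom_yInt (n : ℕ) : pureHom (yInt (n + 1 + 1)) = 0 := by
  have := coe_yInt_succ (n + 1)
  push_cast at this
  simp [pureHom, this, e0, pow_succ]

/-- Only ỹ₀ = -1 and ỹ₁ = e₁ are nonzero and free of e₀. Hence for a ≥ 2 the form kills all ỹₙ,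
which removes most terms in the coefficient comparisons below. -/
theorem pureCoeff_yInt (a : ℕ) (n : ℤ) (h : n ≠ a ∨ 2 ≤ a) : pureCoeff a (yInt n) = 0 := by
  rw [pureCoeff_apply]
  induction n using yInt_cases with
  | hneg n hn => rw [yInt_of_neg hn]; simp
  | h0 =>
    rw [yInt_zero, map_neg, map_one, Polynomial.coeff_neg, Polynomial.coeff_one, if_neg, neg_zero]
    omega
  | hpos n =>
    cases n with
    | zero =>
      rw [Nat.cast_zero, zero_add, pureHom_y1, Polynomial.coeff_X, if_neg]
      omega
    | succ n => push_cast; rw [pureHom_yInt]; simp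

theorem pureCoeff_y1 : pureCoeff 1 y1 = 1 := by
  rw [pureCoeff_apply, pureHom_y1, Polynomial.coeff_X_one]

/-! ## Derivations of `𝒲` and coderivations -/

/-- The endomorphism `D ⊗ id + id ⊗ D`. -/
def tensorDer {E : Type*} [AddCommGroup E] [Module ℚ E] (D : E →ₗ[ℚ] E) :
    E ⊗[ℚ] E →ₗ[ℚ] E ⊗[ℚ] E :=
  TensorProduct.map D LinearMap.id + TensorProduct.map LinearMap.id D

theorem tensorDer_tmul {E : Type*} [AddCommGroup E] [Module ℚ E] (D : E →ₗ[ℚ] E) (a b : E) :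
    tensorDer D (a ⊗ₜ b) = D a ⊗ₜ b + a ⊗ₜ D b := by
  simp [tensorDer]

theorem tensorDer_mul (D : W →ₗ[ℚ] W) (hD : ∀ a b, D (a * b) = D a * b + a * D b)
    (x y : W ⊗[ℚ] W) : tensorDer D (x * y) = tensorDer D x * y + x * tensorDer D y := by
  induction x using TensorProduct.induction_on with
  | zero => simp
  | add x x' hx hx' => rw [add_mul, map_add, hx, hx', map_add, add_mul, add_mul]; abel
  | tmul a b =>
    induction y using TensorProduct.induction_on with
    | zero => simp
    | add y y' hy hy' => rw [mul_add, map_add, hy, hy', map_add, mul_add, mul_add]; abel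
    | tmul c d =>
      rw [Algebra.TensorProduct.tmul_mul_tmul, tensorDer_tmul, tensorDer_tmul, tensorDer_tmul,
        hD, hD, add_mul, mul_add]
      simp only [Algebra.TensorProduct.tmul_mul_tmul, TensorProduct.add_tmul,
        TensorProduct.tmul_add]
      abel

theorem derivation_map_one (D : W →ₗ[ℚ] W) (hD : ∀ a b, D (a * b) = D a * b + a * D b) :
    D 1 = 0 := by
  have := hD 1 1
  rw [mul_one, mul_one, one_mul] at this
  exact left_eq_add.1 this

/-- A derivation of `𝒲` is a coderivation if it is one on the generators. -/
theorem coderivation_of_generators (D : W →ₗ[ℚ] W)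
    (hD : ∀ a b, D (a * b) = D a * b + a * D b)
    (h : ∀ n : ℕ, DeltaW (D (yInt (n + 1))) = tensorDer D (DeltaW (yInt (n + 1)))) (w : W) :
    DeltaW (D w) = tensorDer D (DeltaW w) := by
  induction w using W_induction with
  | hadd a b ha hb => rw [map_add, map_add, ha, hb, map_add, map_add]
  | hmul a b ha hb =>
    rw [hD, map_add, map_mul, map_mul, ha, hb, map_mul, tensorDer_mul D hD]
  | hsmul c a ha => rw [map_smul, map_smul, ha, map_smul, map_smul]
  | h1 =>
    rw [derivation_map_one D hD, map_zero, map_one, Algebra.TensorProduct.one_def,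
      tensorDer_tmul, derivation_map_one D hD]
    simp
  | hy n => rw [← yInt_succ]; exact h n

/-- Primitive elements of `𝒲`. -/
def IsPrimW (p : W) : Prop := DeltaW p = p ⊗ₜ[ℚ] 1 + 1 ⊗ₜ[ℚ] p

theorem IsPrimW.smul {p : W} (h : IsPrimW p) (c : ℚ) : IsPrimW (c • p) := by
  rw [IsPrimW, map_smul, h, smul_add, TensorProduct.smul_tmul', TensorProduct.tmul_smul]

theorem IsPrimW.coderivation {p : W} (h : IsPrimW p) (D : W →ₗ[ℚ] W) (h1 : D 1 = 0)
    (hD : ∀ w, DeltaW (D w) = tensorDer D (DeltaW w)) : IsPrimW (D p) := by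
  rw [IsPrimW, hD, h, map_add, tensorDer_tmul, tensorDer_tmul, h1]
  simp

/-- The restriction of `∂₀` to `𝒲`. -/
def partialW : W →ₗ[ℚ] W :=
  (partial0 ∘ₗ W.val.toLinearMap).codRestrict W.toSubmodule (by
    rintro ⟨_, c, v, rfl⟩
    change partial0 (algebraMap ℚ V c + v * e1) ∈ W
    rw [map_add, partial0_algebraMap, zero_add, partial0_mul, partial0_e1, mul_zero, add_zero]
    exact mul_e1_mem _)

theorem coe_partialW (w : W) : (partialW w : V) = partial0 (w : V) := rfl

theorem partialW_mul (a b : W) : partialW (a * b) = partialW a * b + a * partialW b :=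
  Subtype.ext (partial0_mul a b)

theorem partialW_yInt (n : ℤ) : partialW (yInt n) = ((n : ℚ) - 1) • yInt (n - 1) := by
  induction n using yInt_cases with
  | hneg n h => rw [yInt_of_neg h, yInt_of_neg (n := n - 1) (by omega)]; simp
  | h0 =>
    rw [yInt_zero, yInt_of_neg (n := 0 - 1) (by omega), map_neg,
      derivation_map_one _ partialW_mul]
    simp
  | hpos n =>
    rw [add_sub_cancel_right]
    push_cast
    rw [add_sub_cancel_right]
    apply Subtype.ext
    rw [coe_partialW, coe_yInt_succ, partial0_mul, partial0_e1, mul_zero, add_zero]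
    cases n with
    | zero => simp [partial0_one]
    | succ n =>
      rw [partial0_e0_pow, smul_mul_assoc]
      push_cast
      rw [← coe_yInt_succ]

/-- On the coproduct of ỹₙ₊₁, an index shift in the first factor gives ỹ_b ⊗ ỹₙ₋_b the total
coefficient b + (n - b) = n, which is the factor in ∂₀(ỹₙ₊₁) = n ỹₙ. -/
theorem DeltaW_partialW (w : W) : DeltaW (partialW w) = tensorDer partialW (DeltaW w) := by
  refine coderivation_of_generators _ partialW_mul (fun n => ?_) w
  rw [partialW_yInt, map_smul, DeltaW_yInt _ (n + 1) (by push_cast; omega),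
    DeltaW_yInt _ (n + 2) (by push_cast; omega), map_smul, smul_comm, map_sum]
  simp only [tensorDer_tmul, partialW_yInt, Finset.sum_add_distrib]
  rw [Finset.sum_range_succ' (n := n + 1)
    (f := fun b => ((((b : ℤ) : ℚ) - 1) • yInt ((b : ℤ) - 1)) ⊗ₜ[ℚ] yInt (n + 1 - b)),
    Finset.sum_range_succ (n := n + 1)
    (f := fun b => yInt b ⊗ₜ[ℚ] ((((n + 1 - b : ℤ) : ℚ) - 1) • yInt ((n + 1 - b : ℤ) - 1)))]
  rw [yInt_of_neg (n := ((0 : ℕ) : ℤ) - 1) (by simp),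
    yInt_of_neg (n := ((n : ℤ) + 1 - ((n + 1 : ℕ) : ℤ)) - 1) (by push_cast; omega)]
  simp only [smul_zero, TensorProduct.zero_tmul, TensorProduct.tmul_zero, add_zero]
  rw [← Finset.sum_add_distrib, Finset.smul_sum]
  congr 1
  refine Finset.sum_congr rfl fun b _ => ?_
  have h1 : ((b + 1 : ℕ) : ℤ) - 1 = b := by push_cast; ring
  have h2 : (n : ℤ) + 1 - ((b + 1 : ℕ) : ℤ) = (n : ℤ) + 1 - 1 - b := by push_cast; ring
  have h3 : (n : ℤ) + 1 - (b : ℤ) - 1 = (n : ℤ) + 1 - 1 - b := by ring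
  rw [h1, h2, h3, ← TensorProduct.smul_tmul', TensorProduct.tmul_smul, ← add_smul]
  congr 1
  push_cast
  ring

theorem augW_partialW (w : W) : augW (partialW w) = 0 := by
  induction w using W_induction with
  | hadd a b ha hb => rw [map_add, map_add, ha, hb, add_zero]
  | hmul a b ha hb => rw [partialW_mul, map_add, map_mul, map_mul, ha, hb]; simp
  | hsmul c a ha => rw [map_smul, map_smul, ha, smul_zero]
  | h1 => rw [derivation_map_one _ partialW_mul, map_zero]
  | hy n =>
    rw [← yInt_succ, partialW_yInt, map_smul]
    rcases Nat.eq_zero_or_pos n with rfl | hn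
    · simp
    · rw [augW_yInt _ (by omega), smul_zero]

theorem depthOne_partialW (n : ℕ) (w : W) :
    depthOne n (partialW w) = ((n : ℚ) + 1) * depthOne (n + 1) w := by
  induction w using W_induction with
  | hadd a b ha hb => rw [map_add, map_add, ha, hb, map_add]; ring
  | hmul a b ha hb =>
    rw [partialW_mul, map_add, depthOne_mul, depthOne_mul, depthOne_mul, ha, hb, augW_partialW,
      augW_partialW]
    ring
  | hsmul c a ha => rw [map_smul, map_smul, ha, map_smul, smul_eq_mul, smul_eq_mul]; ring
  | h1 => rw [derivation_map_one _ partialW_mul, map_zero, depthOne_one, mul_zero]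
  | hy m =>
    rw [← yInt_succ, partialW_yInt, map_smul, depthOne_yInt, depthOne_yInt, smul_eq_mul]
    by_cases h : m = n + 1
    · subst h; rw [if_pos (by push_cast; ring), if_pos (by ring)]; push_cast; ring
    · rw [if_neg (by omega), if_neg (by push_cast; omega)]; simp

/-! ## The antiautomorphism `ỹₙ ↦ (-1)ⁿ ỹₙ` of `𝒲` -/

/-- The antiautomorphism of `𝒲` with `ỹₙ ↦ (-1)ⁿ ỹₙ`. -/
def signRev : W →ₗ[ℚ] W :=
  (MulOpposite.opLinearEquiv ℚ).symm.toLinearMap ∘ₗ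
    (liftW fun n : ℕ => MulOpposite.op ((-1 : ℚ) ^ n • yTilde n)).toLinearMap

theorem signRev_mul (a b : W) : signRev (a * b) = signRev b * signRev a := by
  simp [signRev]

theorem signRev_one : signRev 1 = 1 := by simp [signRev]

theorem signRev_yInt (n : ℤ) : signRev (yInt n) = (-1 : ℚ) ^ n • yInt n := by
  induction n using yInt_cases with
  | hneg n h => rw [yInt_of_neg h, map_zero, smul_zero]
  | h0 => rw [yInt_zero, map_neg, signRev_one]; simp
  | hpos n =>
    rw [yInt_succ]
    have : ((n : ℤ) + 1) = ((n + 1 : ℕ) : ℤ) := by push_cast; rfl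
    rw [this, zpow_natCast]
    simp only [signRev, LinearMap.comp_apply, AlgHom.toLinearMap_apply, liftW_yTilde]
    rfl

theorem map_signRev_mul (x y : W ⊗[ℚ] W) :
    TensorProduct.map signRev signRev (x * y) =
      TensorProduct.map signRev signRev y * TensorProduct.map signRev signRev x := by
  induction x using TensorProduct.induction_on with
  | zero => simp
  | add x x' hx hx' => rw [add_mul, map_add, hx, hx', map_add, mul_add]
  | tmul a b =>
    induction y using TensorProduct.induction_on with
    | zero => simp
    | add y y' hy hy' => rw [mul_add, map_add, hy, hy', map_add, add_mul]
    | tmul c d =>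
      simp only [Algebra.TensorProduct.tmul_mul_tmul, TensorProduct.map_tmul, signRev_mul]

/-- The sign (-1)ⁿ is multiplicative along the terms ỹ_b ⊗ ỹₙ₋_b, and both sides reverse products.
Hence T preserves primitivity. -/
theorem DeltaW_signRev (w : W) :
    DeltaW (signRev w) = TensorProduct.map signRev signRev (DeltaW w) := by
  induction w using W_induction with
  | hadd a b ha hb => rw [map_add, map_add, ha, hb, map_add, map_add]
  | hmul a b ha hb => rw [signRev_mul, map_mul, map_mul, ha, hb, map_signRev_mul]
  | hsmul c a ha => rw [map_smul, map_smul, ha, map_smul, map_smul]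
  | h1 =>
    rw [signRev_one, map_one, Algebra.TensorProduct.one_def, TensorProduct.map_tmul, signRev_one]
  | hy n =>
    rw [← yInt_succ, signRev_yInt, map_smul, DeltaW_yInt _ (n + 2) (by push_cast; omega),
      map_smul, map_sum, smul_comm, Finset.smul_sum]
    congr 1
    refine Finset.sum_congr rfl fun b _ => ?_
    rw [TensorProduct.map_tmul, signRev_yInt, signRev_yInt, TensorProduct.smul_tmul',
      TensorProduct.tmul_smul, TensorProduct.smul_tmul', smul_smul, ← zpow_add₀ (by norm_num)]
    congr 3
    ring

theorem IsPrimW.signRev {p : W} (h : IsPrimW p) : IsPrimW (signRev p) := by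
  rw [IsPrimW, DeltaW_signRev, h, map_add, TensorProduct.map_tmul, TensorProduct.map_tmul,
    signRev_one]

theorem augW_signRev (w : W) : augW (signRev w) = augW w := by
  induction w using W_induction with
  | hadd a b ha hb => rw [map_add, map_add, ha, hb, map_add]
  | hmul a b ha hb => rw [signRev_mul, map_mul, map_mul, ha, hb, mul_comm]
  | hsmul c a ha => rw [map_smul, map_smul, ha, map_smul]
  | h1 => rw [signRev_one]
  | hy n => rw [← yInt_succ, signRev_yInt, map_smul, augW_yInt _ (by omega), smul_zero]

theorem depthOne_signRev (n : ℕ) (w : W) :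
    depthOne n (signRev w) = (-1) ^ (n + 1) * depthOne n w := by
  induction w using W_induction with
  | hadd a b ha hb => rw [map_add, map_add, ha, hb, map_add]; ring
  | hmul a b ha hb =>
    rw [signRev_mul, depthOne_mul, depthOne_mul, ha, hb, augW_signRev, augW_signRev]; ring
  | hsmul c a ha => rw [map_smul, map_smul, ha, map_smul, smul_eq_mul, smul_eq_mul]; ring
  | h1 => rw [signRev_one, depthOne_one, mul_zero]
  | hy m =>
    rw [← yInt_succ, signRev_yInt, map_smul, depthOne_yInt, smul_eq_mul]
    by_cases h : m = n
    · subst h; rw [← zpow_natCast]; push_cast; rfl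
    · rw [if_neg (by omega)]; simp

/-- On a generator, reversing e₀ⁿ e₁ and appending e₁ gives e₁ · e₀ⁿ e₁ up to sign: moving e₁ across
turns the antipode of `𝒱` into T. -/
theorem antipodeV_mul_e1 (w : W) : antipodeV (w : V) * e1 = e1 * signRev w := by
  induction w using W_induction with
  | hadd a b ha hb =>
    rw [AddMemClass.coe_add, map_add, add_mul, ha, hb, map_add, AddMemClass.coe_add, mul_add]
  | hmul a b ha hb =>
    rw [signRev_mul, MulMemClass.coe_mul, MulMemClass.coe_mul, antipodeV_mul, mul_assoc, ha,
      ← mul_assoc, hb, mul_assoc]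
  | hsmul c a ha =>
    rw [SetLike.val_smul, map_smul, smul_mul_assoc, ha, map_smul, SetLike.val_smul,
      mul_smul_comm]
  | h1 => simp [signRev_one, antipodeV_one]
  | hy n =>
    rw [← yInt_succ, signRev_yInt, SetLike.val_smul, coe_yInt_succ, antipodeV_mul,
      antipodeV_e0_pow, antipodeV_e1, zpow_add₀ (by norm_num), zpow_natCast, mul_assoc]
    simp

/-! ## Expansion of elements killed by `∂₀` -/

theorem exists_projW_add (v : V) : ∃ a, v = projW v + a * e0 := by
  have h : toM (v - projW v) = 0 := by
    rw [map_sub, sub_eq_zero]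
    exact (WtoM_MtoW (toM v)).symm
  obtain ⟨a, ha⟩ := (mem_Ve0 _).1 ((Submodule.Quotient.mk_eq_zero Ve0).1 h)
  exact ⟨a, by rw [ha]; abel⟩

/-- The elements `(-∂₀)ᵏ(p) / k!`. -/
def taylor (p : W) (k : ℕ) : W := ((-1 : ℚ) ^ k / k.factorial) • (partialW ^ k) p

theorem taylor_zero (p : W) : taylor p 0 = p := by simp [taylor]

theorem partialW_taylor (p : W) (k : ℕ) :
    partialW (taylor p k) = (-((k : ℚ) + 1)) • taylor p (k + 1) := by
  have h : (partialW ^ (k + 1)) p = partialW ((partialW ^ k) p) := by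
    rw [pow_succ', Module.End.mul_apply]
  rw [taylor, taylor, map_smul, h, smul_smul, Nat.factorial_succ]
  congr 1
  push_cast
  have : (k.factorial : ℚ) ≠ 0 := by exact_mod_cast k.factorial_ne_zero
  field_simp
  ring

theorem taylor_succ (p : W) (k : ℕ) :
    taylor p (k + 1) = (-1 / ((k : ℚ) + 1)) • partialW (taylor p k) := by
  rw [partialW_taylor, smul_smul]
  have : (-1 / ((k : ℚ) + 1)) * (-((k : ℚ) + 1)) = 1 := by field_simp
  rw [this, one_smul]

theorem exists_taylor_eq_zero (p : W) : ∃ N, taylor p (N + 1) = 0 := by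
  obtain ⟨N, hN⟩ := partial0_nilpotent (p : V)
  refine ⟨N, ?_⟩
  have h : ∀ k, ((partialW ^ k) p : V) = (partial0 ^ k) (p : V) := by
    intro k
    induction k with
    | zero => rfl
    | succ k ih =>
      rw [pow_succ', pow_succ', Module.End.mul_apply, Module.End.mul_apply, coe_partialW, ih]
  have h0 : (partialW ^ (N + 1)) p = 0 := Subtype.ext ((h _).trans (hN _ (Nat.le_succ N)))
  rw [taylor, h0, smul_zero]

theorem IsPrimW.taylor {p : W} (h : IsPrimW p) (k : ℕ) : IsPrimW (taylor p k) := by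
  induction k with
  | zero => rwa [taylor_zero]
  | succ k ih =>
    rw [taylor_succ]
    exact (ih.coderivation _ (derivation_map_one _ partialW_mul) DeltaW_partialW).smul _

/-- The sum telescopes: ∂₀(pₖ e₀ᵏ) = -(k+1) pₖ₊₁ e₀ᵏ + k pₖ e₀ᵏ⁻¹, so only the last boundary term is
left. -/
theorem partial0_sum_taylor (p : W) (N : ℕ) :
    partial0 (∑ k ∈ Finset.range (N + 1), (taylor p k : V) * e0 ^ k) =
      (-((N : ℚ) + 1)) • ((taylor p (N + 1) : V) * e0 ^ N) := by
  have ht : ∀ k, partial0 (taylor p k : V) = (-((k : ℚ) + 1)) • (taylor p (k + 1) : V) :=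
    fun k => congrArg Subtype.val (partialW_taylor p k)
  induction N with
  | zero =>
    have := ht 0
    simpa using this
  | succ N ih =>
    rw [Finset.sum_range_succ, map_add, ih, partial0_mul, ht, partial0_e0_pow, mul_smul_comm,
      smul_mul_assoc]
    push_cast
    module

/-- Both sides are killed by ∂₀ and have the same component in `𝒲`. Their difference lies in 𝒱e₀ and
is killed by ∂₀, hence is zero. -/
theorem eq_sum_taylor (v : V) (hv : partial0 v = 0) (N : ℕ) (hN : taylor (projW v) (N + 1) = 0) :
    v = ∑ k ∈ Finset.range (N + 1), (taylor (projW v) k : V) * e0 ^ k := by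
  obtain ⟨a, ha⟩ := exists_projW_add v
  have hsum : ∑ k ∈ Finset.range (N + 1), (taylor (projW v) k : V) * e0 ^ k =
      projW v + (∑ k ∈ Finset.range N, (taylor (projW v) (k + 1) : V) * e0 ^ k) * e0 := by
    rw [Finset.sum_range_succ', taylor_zero, pow_zero, mul_one, add_comm, Finset.sum_mul]
    simp only [pow_succ, mul_assoc]
  set s := ∑ k ∈ Finset.range N, (taylor (projW v) (k + 1) : V) * e0 ^ k
  have h0 : partial0 ((a - s) * e0) = 0 := by
    have h1 : (a - s) * e0 =
        v - ∑ k ∈ Finset.range (N + 1), (taylor (projW v) k : V) * e0 ^ k := by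
      rw [hsum, sub_mul, eq_sub_of_add_eq' ha.symm]; abel
    rw [h1, map_sub, hv, partial0_sum_taylor, hN]
    simp
  rw [hsum, ← sub_eq_zero.1 (eq_zero_of_partial0_mul_e0 _ h0)]
  exact ha

/-! ## The elements `F n` -/

/-- The elements `∑ₖ (pₖ ỹₙ₊ₖ + (-1)ᵏ ỹₙ₊ₖ T(pₖ))` where `pₖ = (-∂₀)ᵏ(p) / k!` and `T` is the
antiautomorphism `ỹₙ ↦ (-1)ⁿ ỹₙ`. -/
def F (p : W) (N : ℕ) (n : ℤ) : W :=
  ∑ k ∈ Finset.range N,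
    (taylor p k * yInt (n + k) + (-1 : ℚ) ^ k • (yInt (n + k) * signRev (taylor p k)))

theorem DeltaW_prim_mul_yInt {p : W} (h : IsPrimW p) (n : ℤ) (B : ℕ) (hB : n < B) :
    DeltaW (p * yInt n) = (-1 : ℚ) • ∑ b ∈ Finset.range B,
      ((p * yInt (n - b)) ⊗ₜ[ℚ] yInt b + yInt b ⊗ₜ[ℚ] (p * yInt (n - b))) := by
  rw [map_mul, h, add_mul, Finset.sum_add_distrib, smul_add]
  nth_rewrite 1 [DeltaW_yInt' n B hB]
  rw [DeltaW_yInt n B hB, mul_smul_comm, mul_smul_comm, Finset.mul_sum, Finset.mul_sum]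
  simp only [Algebra.TensorProduct.tmul_mul_tmul, one_mul]

theorem DeltaW_yInt_mul_prim {p : W} (h : IsPrimW p) (n : ℤ) (B : ℕ) (hB : n < B) :
    DeltaW (yInt n * p) = (-1 : ℚ) • ∑ b ∈ Finset.range B,
      ((yInt (n - b) * p) ⊗ₜ[ℚ] yInt b + yInt b ⊗ₜ[ℚ] (yInt (n - b) * p)) := by
  rw [map_mul, h, mul_add, Finset.sum_add_distrib, smul_add]
  nth_rewrite 1 [DeltaW_yInt' n B hB]
  rw [DeltaW_yInt n B hB, smul_mul_assoc, smul_mul_assoc, Finset.sum_mul, Finset.sum_mul]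
  simp only [Algebra.TensorProduct.tmul_mul_tmul, mul_one]

/-- All pₖ and T(pₖ) are primitive, so each summand obeys the same recursion as ỹₙ₊ₖ. The recursion
involves F at nonpositive arguments, which is why F is defined on all of ℤ. -/
theorem DeltaW_F {p : W} (h : IsPrimW p) (N : ℕ) (n : ℤ) (B : ℕ) (hB : n + N ≤ B) :
    DeltaW (F p N n) = (-1 : ℚ) • ∑ b ∈ Finset.range B,
      (F p N (n - b) ⊗ₜ[ℚ] yInt b + yInt b ⊗ₜ[ℚ] F p N (n - b)) := by
  have hterm : ∀ k ∈ Finset.range N, DeltaW (taylor p k * yInt (n + k) +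
      (-1 : ℚ) ^ k • (yInt (n + k) * signRev (taylor p k))) =
      (-1 : ℚ) • ∑ b ∈ Finset.range B,
        ((taylor p k * yInt (n - b + k) +
          (-1 : ℚ) ^ k • (yInt (n - b + k) * signRev (taylor p k))) ⊗ₜ[ℚ] yInt b +
        yInt b ⊗ₜ[ℚ] (taylor p k * yInt (n - b + k) +
          (-1 : ℚ) ^ k • (yInt (n - b + k) * signRev (taylor p k)))) := by
    intro k hk
    have hk' : n + k < B := by have := Finset.mem_range.1 hk; omega
    rw [map_add, map_smul, DeltaW_prim_mul_yInt (h.taylor k) _ B hk',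
      DeltaW_yInt_mul_prim (h.taylor k).signRev _ B hk', smul_comm, ← smul_add,
      Finset.smul_sum, ← Finset.sum_add_distrib]
    congr 1
    refine Finset.sum_congr rfl fun b _ => ?_
    have hb : n + k - b = n - b + k := by ring
    rw [hb, TensorProduct.add_tmul, TensorProduct.tmul_add, smul_add, TensorProduct.smul_tmul',
      TensorProduct.tmul_smul]
    abel
  rw [F, map_sum, Finset.sum_congr rfl hterm, ← Finset.smul_sum, Finset.sum_comm]
  congr 1
  refine Finset.sum_congr rfl fun b _ => ?_
  rw [Finset.sum_add_distrib, F, TensorProduct.sum_tmul, TensorProduct.tmul_sum]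

theorem augW_taylor {p : W} (h : augW p = 0) (k : ℕ) : augW (taylor p k) = 0 := by
  cases k with
  | zero => rwa [taylor_zero]
  | succ k => rw [taylor_succ, map_smul, augW_partialW, smul_zero]

theorem depthOne_taylor {p : W} (h : ∀ n, Odd n → depthOne n p = 0) (k n : ℕ) (hn : Odd (n + k)) :
    depthOne n (taylor p k) = 0 := by
  induction k generalizing n with
  | zero => rw [taylor_zero]; exact h n hn
  | succ k ih =>
    rw [taylor_succ, map_smul, depthOne_partialW, ih (n + 1) (by rwa [add_right_comm])]
    simp

/-- If the coefficients of `ỹₙ` in `p` vanish for even `n`, the elements `F n` have no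
component in the span of the `ỹₙ`. -/
theorem depthOne_F {p : W} (h0 : augW p = 0) (h : ∀ n, Odd n → depthOne n p = 0) (N : ℕ)
    (n : ℕ) (m : ℤ) : depthOne n (F p N m) = 0 := by
  rw [F, map_sum]
  refine Finset.sum_eq_zero fun k _ => ?_
  rw [map_add, map_smul, depthOne_mul, depthOne_mul, augW_signRev, augW_taylor h0,
    depthOne_signRev, smul_eq_mul]
  -- For n + k even the contributions of pₖ and T(pₖ) cancel; for n + k odd each is zero.
  rcases Nat.even_or_odd (n + k) with hk | hk
  · have : (-1 : ℚ) ^ k * (-1) ^ (n + 1) = -1 := by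
      rw [← pow_add, show k + (n + 1) = n + k + 1 by ring, pow_succ, hk.neg_one_pow]; ring
    linear_combination (depthOne n) (taylor p k) * augW (yInt (m + k)) * this
  · rw [depthOne_taylor h k n hk]; ring

/-! ### Coefficients of coproducts of polynomials in ỹ₁ -/

/-- A tensor product of two linear forms. -/
def pairing (f g : W →ₗ[ℚ] ℚ) : W ⊗[ℚ] W →ₗ[ℚ] ℚ :=
  LinearMap.mul' ℚ ℚ ∘ₗ TensorProduct.map f g

theorem pairing_tmul (f g : W →ₗ[ℚ] ℚ) (a b : W) : pairing f g (a ⊗ₜ b) = f a * g b := by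
  simp [pairing]

theorem DeltaW_y1_pow (k : ℕ) :
    DeltaW (y1 ^ k) =
      ∑ i ∈ Finset.range (k + 1), (k.choose i : ℚ) • ((y1 ^ i) ⊗ₜ[ℚ] (y1 ^ (k - i))) := by
  have h1 : DeltaW y1 = y1 ⊗ₜ[ℚ] 1 + 1 ⊗ₜ[ℚ] y1 := by
    rw [y1, DeltaW_yInt 1 2 (by norm_num), Finset.sum_range_succ, Finset.sum_range_one]
    have h : (-1 : W) = (-1 : ℚ) • 1 := by simp
    simp only [Nat.cast_zero, Nat.cast_one, sub_zero, sub_self, yInt_zero]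
    rw [h, TensorProduct.tmul_smul, ← TensorProduct.smul_tmul', smul_add, smul_smul, smul_smul]
    norm_num
    rw [add_comm]
  have hc : Commute (y1 ⊗ₜ[ℚ] (1 : W)) ((1 : W) ⊗ₜ[ℚ] y1) := by
    simp [Commute, SemiconjBy, Algebra.TensorProduct.tmul_mul_tmul]
  rw [map_pow, h1, hc.add_pow]
  refine Finset.sum_congr rfl fun i _ => ?_
  rw [Algebra.TensorProduct.tmul_pow, Algebra.TensorProduct.tmul_pow,
    Algebra.TensorProduct.tmul_mul_tmul, one_pow, one_pow, mul_one, one_mul, ← nsmul_eq_mul',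
    Nat.cast_smul_eq_nsmul]

theorem pureCoeff_y1_pow (a k : ℕ) : pureCoeff a (y1 ^ k) = if a = k then 1 else 0 := by
  rw [pureCoeff_apply, map_pow, pureHom_y1, Polynomial.coeff_X_pow]

theorem pairing_DeltaW_aeval_y1 (a b : ℕ) (Q : Polynomial ℚ) :
    pairing (pureCoeff a) (pureCoeff b) (DeltaW (Polynomial.aeval y1 Q)) =
      ((a + b).choose a : ℚ) * Q.coeff (a + b) := by
  induction Q using Polynomial.induction_on' with
  | add P Q hP hQ => rw [map_add, map_add, map_add, hP, hQ, Polynomial.coeff_add, mul_add]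
  | monomial k c =>
    rw [Polynomial.aeval_monomial, ← Algebra.smul_def, map_smul, map_smul, DeltaW_y1_pow, map_sum,
      Polynomial.coeff_monomial]
    simp only [map_smul, pairing_tmul, pureCoeff_y1_pow]
    by_cases h : k = a + b
    · subst h
      rw [Finset.sum_eq_single a]
      · simp [mul_comm]
      · intro i _ hi
        rw [if_neg (Ne.symm hi)]; simp
      · intro ha; simp at ha
    · rw [if_neg h, Finset.sum_eq_zero]
      · simp
      · intro i hi
        have := Finset.mem_range.1 hi
        by_cases hi' : a = i
        · rw [if_neg (c := b = k - i) (by omega)]; simp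
        · rw [if_neg hi']; simp

/-- Only the term ỹ₀ ⊗ ỹ₂ of Δ(ỹ₂), multiplied by ỹ₁² ⊗ 1, is detected. The signs of Δ and of ỹ₀ =
-1 cancel. -/
theorem pairing_DeltaW_y2_mul (Q : Polynomial ℚ) :
    pairing (pureCoeff 2) (depthOne 1) (DeltaW (yInt 2 * Polynomial.aeval y1 Q)) =
      Q.coeff 2 := by
  induction Q using Polynomial.induction_on' with
  | add P Q hP hQ => rw [map_add, mul_add, map_add, map_add, hP, hQ, Polynomial.coeff_add]
  | monomial k c =>
    have haug : augW y1 = 0 := augW_yInt 1 (by norm_num)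
    have hterm : ∀ i, pairing (pureCoeff 2) (depthOne 1)
        (DeltaW (yInt 2) * ((y1 ^ i) ⊗ₜ[ℚ] (y1 ^ (k - i)))) =
        if i = 2 ∧ k - i = 0 then 1 else 0 := by
      intro i
      have h2 : pureCoeff 2 (yInt 2 * y1 ^ i) = 0 := by
        have := pureHom_yInt 0
        norm_num at this
        rw [pureCoeff_apply, map_mul, this, zero_mul, Polynomial.coeff_zero]
      have h0 : pureCoeff 2 (yInt 0 * y1 ^ i) = -(if 2 = i then 1 else 0) := by
        have h : (-1 : W) = (-1 : ℚ) • 1 := by simp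
        rw [yInt_zero, h, smul_mul_assoc, one_mul, map_smul, pureCoeff_y1_pow, smul_eq_mul,
          neg_one_mul]
      have hd1 : depthOne 1 (yInt 1 * y1 ^ (k - i)) = 0 := by
        rw [depthOne_mul, depthOne_yInt, haug]; simp
      have hd2 : depthOne 1 (yInt 2 * y1 ^ (k - i)) = if k - i = 0 then 1 else 0 := by
        rw [depthOne_mul, depthOne_yInt, augW_yInt 2 (by norm_num), map_pow, haug, zero_pow_eq]
        simp
      rw [DeltaW_yInt 2 3 (by norm_num), smul_mul_assoc, map_smul, Finset.sum_mul, map_sum]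
      simp only [Algebra.TensorProduct.tmul_mul_tmul, pairing_tmul, Finset.sum_range_succ,
        Finset.sum_range_zero, Nat.cast_zero, Nat.cast_one, Nat.cast_ofNat, sub_zero,
        show (2 : ℤ) - 1 = 1 by norm_num, h2, h0, hd1, hd2]
      by_cases hi : i = 2 <;> by_cases hk : k - i = 0 <;> simp [hi, hk, eq_comm (a := 2)]
    rw [Polynomial.aeval_monomial, ← Algebra.smul_def, mul_smul_comm, map_smul, map_smul, map_mul,
      DeltaW_y1_pow, Finset.mul_sum, map_sum, Polynomial.coeff_monomial]
    simp only [mul_smul_comm, map_smul, hterm]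
    by_cases h : k = 2
    · subst h; simp [Finset.sum_range_succ]
    · rw [if_neg h, Finset.sum_eq_zero]
      · simp
      · intro i hi
        have := Finset.mem_range.1 hi
        rw [if_neg (by omega)]; simp

/-! ## The polynomial correction in `θ` -/

/-- The polynomial `∑_{n ≥ 1} (1/n) (x | e₀ⁿ⁻¹ e₁) Xⁿ`. -/
def thetaPoly (x : V) : Polynomial ℚ :=
  Finsupp.linearCombination ℚ
    (fun n : ℕ => (1 / ((n : ℚ) + 1)) • (Polynomial.X : Polynomial ℚ) ^ (n + 1))
    (Finsupp.lcomapDomain (R := ℚ) word01 word01_injective (wordBasis.repr x))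

theorem aeval_thetaPoly (x : V) : Polynomial.aeval e1 (thetaPoly x) = thetaCorr x := by
  simp [thetaPoly, thetaCorr, Finsupp.linearCombination_apply, Finsupp.sum]

theorem thetaPoly_coeff_zero (x : V) : (thetaPoly x).coeff 0 = 0 := by
  simp [thetaPoly, Finsupp.linearCombination_apply, Finsupp.sum]

theorem thetaPoly_coeff_succ (x : V) (n : ℕ) :
    (thetaPoly x).coeff (n + 1) = 1 / ((n : ℚ) + 1) * coeff (word01 n) x := by
  rw [thetaPoly, Finsupp.linearCombination_apply, Finsupp.sum, Polynomial.finsetSum_coeff]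
  simp only [Polynomial.coeff_smul, Polynomial.coeff_X_pow, smul_eq_mul, Nat.add_right_cancel_iff]
  rw [Finset.sum_eq_single n]
  · simp [coeff, mul_comm]
  · intro m _ hm
    rw [if_neg (Ne.symm hm)]; simp
  · intro h
    rw [Finsupp.notMem_support_iff.1 h, zero_mul]

theorem coe_aeval_y1 (Q : Polynomial ℚ) :
    (Polynomial.aeval y1 Q : V) = Polynomial.aeval e1 Q := by
  rw [← coe_y1]
  exact (Polynomial.aeval_algHom_apply W.val y1 Q).symm

/-- The symmetrization `Q(X) + Q(-X)`. -/
def evenPart (Q : Polynomial ℚ) : Polynomial ℚ := Q + Q.comp (-Polynomial.X)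

theorem evenPart_coeff (Q : Polynomial ℚ) (n : ℕ) :
    (evenPart Q).coeff n = (1 + (-1) ^ n) * Q.coeff n := by
  induction Q using Polynomial.induction_on' with
  | add P Q hP hQ =>
    have : evenPart (P + Q) = evenPart P + evenPart Q := by
      simp only [evenPart, Polynomial.add_comp]; ring
    rw [this, Polynomial.coeff_add, hP, hQ, Polynomial.coeff_add]; ring
  | monomial k c =>
    have : evenPart (Polynomial.monomial k c) = Polynomial.monomial k ((1 + (-1) ^ k) * c) := by
      simp only [evenPart, ← Polynomial.C_mul_X_pow_eq_monomial, Polynomial.mul_comp,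
        Polynomial.C_comp, Polynomial.pow_comp, Polynomial.X_comp, neg_pow (Polynomial.X : Polynomial ℚ) k, map_mul,
        map_add, map_one, map_pow, map_neg]
      ring
    rw [this, Polynomial.coeff_monomial, Polynomial.coeff_monomial]
    split_ifs with h
    · rw [h]
    · ring

theorem aeval_y1_evenPart (Q : Polynomial ℚ) :
    Polynomial.aeval y1 (evenPart Q) =
      Polynomial.aeval y1 Q + signRev (Polynomial.aeval y1 Q) := by
  have h : ∀ k, signRev (y1 ^ k) = (-1 : ℚ) ^ k • y1 ^ k := by
    intro k
    induction k with
    | zero => simp [signRev_one]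
    | succ k ih =>
      rw [pow_succ y1, signRev_mul, ih, signRev_yInt, zpow_one, smul_mul_smul_comm, ← pow_succ',
        ← pow_succ', ← pow_succ]
  rw [evenPart, map_add]
  congr 1
  induction Q using Polynomial.induction_on' with
  | add P Q hP hQ => rw [Polynomial.add_comp, map_add, hP, hQ, map_add, map_add]
  | monomial k c =>
    rw [Polynomial.aeval_monomial, ← Algebra.smul_def, map_smul, h,
      ← Polynomial.C_mul_X_pow_eq_monomial, Polynomial.mul_comp, Polynomial.C_comp,
      Polynomial.pow_comp, Polynomial.X_comp, map_mul, map_pow, map_neg, Polynomial.aeval_X,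
      Polynomial.aeval_C, ← Algebra.smul_def]
    congr 1
    rcases Nat.even_or_odd k with hk | hk
    · rw [hk.neg_one_pow, one_smul]; exact hk.neg_pow (y1 : W)
    · rw [hk.neg_one_pow, neg_one_smul]; exact hk.neg_pow (y1 : W)

theorem partial0_aeval_e1 (Q : Polynomial ℚ) : partial0 (Polynomial.aeval e1 Q) = 0 := by
  induction Q using Polynomial.induction_on' with
  | add P Q hP hQ => rw [map_add, map_add, hP, hQ, add_zero]
  | monomial k c =>
    rw [Polynomial.aeval_monomial, ← Algebra.smul_def, map_smul, partial0_e1_pow, smul_zero]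

theorem coeff_word01_aeval_e1 (n : ℕ) (hn : n ≠ 0) (Q : Polynomial ℚ) :
    coeff (word01 n) (Polynomial.aeval e1 Q) = 0 := by
  induction Q using Polynomial.induction_on' with
  | add P Q hP hQ => rw [map_add, map_add, hP, hQ, add_zero]
  | monomial k c =>
    rw [Polynomial.aeval_monomial, ← Algebra.smul_def, map_smul]
    cases k with
    | zero => rw [pow_zero, coeff_word01_one, smul_zero]
    | succ k => rw [pow_succ', coeff_word01_e1_mul, if_neg hn, smul_zero]

/-! ## The element `θ(x)` -/

theorem theta_eq (x : lie) :
    theta x = (x : V) - coeff (FreeMonoid.of 0) (x : V) • e0 +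
      Polynomial.aeval e1 (thetaPoly (x : V)) := by
  rw [aeval_thetaPoly]; rfl

theorem partial0_theta (x : lie) : partial0 (theta x) = 0 := by
  rw [theta_eq, map_add, map_sub, map_smul, partial0_e0, partial0_aeval_e1, partial0_lie,
    Algebra.algebraMap_eq_smul_one]
  simp

theorem antipodeV_theta_sub (x : lie) :
    antipodeV (theta x - Polynomial.aeval e1 (thetaPoly (x : V))) =
      -(theta x - Polynomial.aeval e1 (thetaPoly (x : V))) := by
  rw [theta_eq, add_sub_cancel_right, map_sub, map_smul, antipodeV_e0, antipodeV_lie]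
  module

theorem augW_projW (v : V) : augW (projW v) = aug v := by
  obtain ⟨a, ha⟩ := exists_projW_add v
  conv_rhs => rw [ha, map_add, map_mul, aug_e0, mul_zero, add_zero]
  rfl

theorem depthOne_projW (n : ℕ) (v : V) : depthOne n (projW v) = coeff (word01 n) v := by
  obtain ⟨a, ha⟩ := exists_projW_add v
  conv_rhs => rw [ha, map_add, coeff_word01_mul_e0, add_zero]
  rfl

theorem augW_projW_theta (x : lie) : augW (projW (theta x)) = 0 := by
  rw [augW_projW, theta_eq, map_add, map_sub, map_smul, aug_e0, aug_lie,
    ← Polynomial.aeval_algHom_apply, aug_e1, ← Polynomial.coeff_zero_eq_aeval_zero,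
    thetaPoly_coeff_zero]
  simp

theorem depthOne_projW_theta (x : lie) (n : ℕ) (hn : n ≠ 0) :
    depthOne n (projW (theta x)) = coeff (word01 n) (x : V) := by
  have h0 : coeff (word01 n) e0 = 0 := by rw [← one_mul e0, coeff_word01_mul_e0]
  rw [depthOne_projW, theta_eq, map_add, map_sub, map_smul, h0, coeff_word01_aeval_e1 n hn]
  simp

/-! ### The derivation of `𝒲` attached to θ(x) and its values on generators -/

/-- The restriction to `𝒲` of the derivation `der_v^{(1)}`. -/
def derW (v : V) : W →ₗ[ℚ] W :=
  (der1 v ∘ₗ W.val.toLinearMap).codRestrict W.toSubmodule (by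
    rintro ⟨_, c, u, rfl⟩
    change der1 v (algebraMap ℚ V c + u * e1) ∈ W
    rw [map_add, der1_algebraMap, zero_add, der1_mul, der1_e1, mul_zero, add_zero]
    exact mul_e1_mem _)

theorem coe_derW (v : V) (w : W) : (derW v w : V) = der1 v (w : V) := rfl

theorem derW_mul (v : V) (a b : W) : derW v (a * b) = derW v a * b + a * derW v b :=
  Subtype.ext (der1_mul v a b)

theorem derW_y1 (v : V) : derW v y1 = 0 := by
  apply Subtype.ext
  rw [coe_derW, coe_y1, der1_e1]
  rfl

theorem der1_e0_pow (v : V) (n : ℕ) : der1 v (e0 ^ n) = v * e0 ^ n - e0 ^ n * v := by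
  induction n with
  | zero =>
    have := der1_algebraMap v 1
    rw [map_one] at this
    simp [this]
  | succ n ih =>
    rw [pow_succ, der1_mul, ih, der1_e0, Ring.lie_def]
    noncomm_ring

/-- The left side starts from v e₀ⁿ e₁ - e₀ⁿ v e₁. The Taylor expansion of v turns the first term
into ∑ pₖ ỹₙ₊₁₊ₖ. In the second, v e₁ is replaced through the antipode, which produces the terms
ỹₙ₊₁₊ₖ T(pₖ) and, since v is antisymmetric only up to the polynomial c, the correction by the even
part. -/
theorem derW_theta_yInt (x : lie) (N : ℕ) (hN : taylor (projW (theta x)) (N + 1) = 0) (n : ℕ) :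
    derW (theta x) (yInt (n + 1)) + yInt (n + 1) *
      Polynomial.aeval y1 (evenPart (thetaPoly (x : V))) = F (projW (theta x)) (N + 1) (n + 1) := by
  have hv := eq_sum_taylor _ (partial0_theta x) N hN
  have hS := antipodeV_theta_sub x
  set v := theta x
  set p := projW v
  set c : V := Polynomial.aeval e1 (thetaPoly (x : V)) with hc
  have hcw : (Polynomial.aeval y1 (thetaPoly (x : V)) : V) = c := coe_aeval_y1 _
  have hce : c * e1 = e1 * c := by
    have := congrArg (Polynomial.aeval e1) (mul_comm (thetaPoly (x : V)) Polynomial.X)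
    simpa using this
  have hSv : antipodeV v * e1 =
      ∑ k ∈ Finset.range (N + 1), (-1 : ℚ) ^ k • (e0 ^ k * e1 * (signRev (taylor p k) : V)) := by
    conv_lhs => rw [hv]
    rw [map_sum, Finset.sum_mul]
    refine Finset.sum_congr rfl fun k _ => ?_
    rw [antipodeV_mul, antipodeV_e0_pow, mul_assoc, antipodeV_mul_e1, smul_mul_assoc, mul_assoc]
  have hve : v * e1 = -∑ k ∈ Finset.range (N + 1),
      (-1 : ℚ) ^ k • (e0 ^ k * e1 * (signRev (taylor p k) : V)) +
      e1 * (c + signRev (Polynomial.aeval y1 (thetaPoly (x : V)))) := by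
    have h1 := congrArg (· * e1) hS
    simp only [map_sub, sub_mul, neg_mul] at h1
    have h2 := antipodeV_mul_e1 (Polynomial.aeval y1 (thetaPoly (x : V)))
    rw [hcw] at h2
    rw [h2, hSv] at h1
    have h3 := eq_add_of_sub_eq (neg_eq_iff_eq_neg.1 h1.symm)
    rw [h3, mul_add, ← hce]
    abel
  apply Subtype.ext
  rw [AddMemClass.coe_add, coe_derW, MulMemClass.coe_mul, coe_yInt_succ, aeval_y1_evenPart,
    AddMemClass.coe_add, hcw, der1_mul, der1_e1, mul_zero, add_zero, der1_e0_pow, sub_mul,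
    mul_assoc (e0 ^ n) v, hve, F, AddSubmonoidClass.coe_finsetSum, mul_add, mul_neg,
    Finset.mul_sum]
  have hleft : v * e0 ^ n * e1 =
      ∑ k ∈ Finset.range (N + 1), (taylor p k : V) * (yInt (n + 1 + k) : V) := by
    conv_lhs => rw [hv]
    rw [Finset.sum_mul, Finset.sum_mul]
    refine Finset.sum_congr rfl fun k _ => ?_
    have : (n : ℤ) + 1 + k = ((n + k : ℕ) : ℤ) + 1 := by push_cast; ring
    rw [this, coe_yInt_succ, mul_assoc, mul_assoc, ← mul_assoc (e0 ^ k), ← pow_add, add_comm k n]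
  have hright : ∀ k, e0 ^ n * ((-1 : ℚ) ^ k • (e0 ^ k * e1 * (signRev (taylor p k) : V))) =
      (-1 : ℚ) ^ k • ((yInt (n + 1 + k) : V) * (signRev (taylor p k) : V)) := by
    intro k
    have : (n : ℤ) + 1 + k = ((n + k : ℕ) : ℤ) + 1 := by push_cast; ring
    rw [this, coe_yInt_succ, mul_smul_comm, pow_add]
    simp only [mul_assoc]
  rw [hleft, Finset.sum_congr rfl fun k _ => hright k]
  have hF : ∀ k, ((taylor p k * yInt (n + 1 + k) +
      (-1 : ℚ) ^ k • (yInt (n + 1 + k) * signRev (taylor p k)) : W) : V) =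
      (taylor p k : V) * (yInt (n + 1 + k) : V) +
        (-1 : ℚ) ^ k • ((yInt (n + 1 + k) : V) * (signRev (taylor p k) : V)) := fun _ => rfl
  rw [Finset.sum_congr rfl fun k _ => hF k, Finset.sum_add_distrib]
  noncomm_ring

/-! ## Consequences of primitivity -/

variable {x : lie} {N : ℕ}

theorem F_one (hN : taylor (projW (theta x)) (N + 1) = 0) :
    F (projW (theta x)) (N + 1) 1 =
      y1 * Polynomial.aeval y1 (evenPart (thetaPoly (x : V))) := by
  have := derW_theta_yInt x N hN 0
  rw [Nat.cast_zero, zero_add, derW_y1, zero_add] at this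
  exact this.symm

/-- For m ≥ 3, the coefficient of e₁² ⊗ e₁ᵐ⁻¹ in Δ(F(1)) is a nonzero binomial multiple of the
coefficient sought. By `DeltaW_F` it is zero, since every term has some ỹ_b as a factor, and no ỹ_b
contains e₁ᵃ with a ≥ 2. -/
theorem evenPart_coeff_eq_zero (hp : IsPrimW (projW (theta x))) (m : ℕ) (hm : m ≠ 2) :
    (evenPart (thetaPoly (x : V))).coeff m = 0 := by
  rcases Nat.lt_or_ge m 3 with h | h
  · rw [evenPart_coeff]
    interval_cases m
    · rw [thetaPoly_coeff_zero, mul_zero]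
    · norm_num
    · exact absurd rfl hm
  · obtain ⟨k, rfl⟩ : ∃ k, m = k + 3 := ⟨m - 3, by omega⟩
    obtain ⟨N, hN⟩ := exists_taylor_eq_zero (projW (theta x))
    have h1 := congrArg (pairing (pureCoeff 2) (pureCoeff (k + 2)))
      (DeltaW_F hp (N + 1) 1 (N + 2) (by push_cast; omega))
    have hX := pairing_DeltaW_aeval_y1 2 (k + 2)
      (Polynomial.X * evenPart (thetaPoly (x : V)))
    rw [map_mul, Polynomial.aeval_X, ← F_one hN, h1, map_smul, map_sum, Finset.sum_eq_zero,
      smul_zero, show 2 + (k + 2) = k + 3 + 1 by ring, Polynomial.coeff_X_mul] at hX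
    · refine (mul_eq_zero.1 hX.symm).resolve_left ?_
      exact_mod_cast (Nat.choose_pos (by omega)).ne'
    · intro b _
      rw [map_add, pairing_tmul, pairing_tmul, pureCoeff_yInt (k + 2) _ (Or.inr (by omega)),
        pureCoeff_yInt 2 _ (Or.inr le_rfl)]
      simp

/-- Coefficient of e₁² ⊗ e₁ in Δ(F(1)): the 3 is a binomial coefficient, and only F(0) ⊗ ỹ₁ survives
on the other side. -/
theorem three_mul_evenPart_coeff_two (hp : IsPrimW (projW (theta x)))
    (hN : taylor (projW (theta x)) (N + 1) = 0) :
    3 * (evenPart (thetaPoly (x : V))).coeff 2 =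
      -pureCoeff 2 (F (projW (theta x)) (N + 1) 0) := by
  have h1 := congrArg (pairing (pureCoeff 2) (pureCoeff 1))
    (DeltaW_F hp (N + 1) 1 (N + 2) (by push_cast; omega))
  have hX := pairing_DeltaW_aeval_y1 2 1 (Polynomial.X * evenPart (thetaPoly (x : V)))
  rw [map_mul, Polynomial.aeval_X, ← F_one hN, h1, map_smul, map_sum,
    Finset.sum_eq_single 1, Polynomial.coeff_X_mul] at hX
  · rw [map_add, pairing_tmul, pairing_tmul, pureCoeff_yInt 2 _ (Or.inr le_rfl), Nat.cast_one,
      pureCoeff_y1, sub_self] at hX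
    norm_num [Nat.choose] at hX
    linarith
  · intro b _ hb
    rw [map_add, pairing_tmul, pairing_tmul, pureCoeff_yInt 1 _ (Or.inl (by exact_mod_cast hb)),
      pureCoeff_yInt 2 _ (Or.inr le_rfl)]
    simp
  · intro h; simp at h

/-- Pairing Δ(F(2)) with e₁² ⊗ ỹ₂ expresses the same coefficient of F(0) without the factor 3,
because the coderivation property makes the contribution of der(ỹ₂) vanish. Hence 3q = q. -/
theorem evenPart_coeff_two_eq_zero (hp : IsPrimW (projW (theta x)))
    (h : ∀ w, DeltaW (derW (theta x) w) = tensorDer (derW (theta x)) (DeltaW w)) :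
    (evenPart (thetaPoly (x : V))).coeff 2 = 0 := by
  obtain ⟨N, hN⟩ := exists_taylor_eq_zero (projW (theta x))
  have h3 := three_mul_evenPart_coeff_two hp hN
  have hd : pairing (pureCoeff 2) (depthOne 1) (DeltaW (derW (theta x) (yInt 2))) = 0 := by
    have hy := pureCoeff_yInt 2 0 (Or.inr le_rfl)
    rw [h, DeltaW_yInt 2 3 (by norm_num), map_smul, map_smul, map_sum, map_sum]
    have h0 : derW (theta x) (yInt 0) = 0 := by
      rw [yInt_zero, map_neg, derivation_map_one _ (derW_mul _), neg_zero]
    simp only [Finset.sum_range_succ, Finset.sum_range_zero, Nat.cast_zero, Nat.cast_one,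
      Nat.cast_ofNat, tensorDer_tmul, map_add, pairing_tmul, derW_y1, h0, sub_zero, map_zero,
      show (2 : ℤ) - 1 = 1 by norm_num, sub_self, hy, depthOne_yInt]
    norm_num
  have hF := derW_theta_yInt x N hN 1
  rw [Nat.cast_one, one_add_one_eq_two] at hF
  have hΔ := congrArg (pairing (pureCoeff 2) (depthOne 1))
    (DeltaW_F hp (N + 1) 2 (N + 3) (by push_cast; omega))
  rw [← hF, map_add, map_add, hd, pairing_DeltaW_y2_mul, map_smul, map_sum,
    Finset.sum_eq_single 2, map_add, pairing_tmul, pairing_tmul,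
    pureCoeff_yInt 2 _ (Or.inr le_rfl), depthOne_yInt, Nat.cast_ofNat, sub_self] at hΔ
  · norm_num at hΔ
    linarith
  · intro b _ hb
    rw [map_add, pairing_tmul, pairing_tmul, pureCoeff_yInt 2 _ (Or.inr le_rfl), depthOne_yInt,
      if_neg (by push_cast; omega)]
    simp
  · intro h; simp at h

theorem F_nonpos_eq_zero (hp : IsPrimW (projW (theta x)))
    (hx : evenPart (thetaPoly (x : V)) = 0) (hN : taylor (projW (theta x)) (N + 1) = 0) (j : ℕ) :
    F (projW (theta x)) (N + 1) (-j) = 0 := by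
  -- Vanishing of the even part of the polynomial means that (x|e₀ⁿe₁) = 0 for odd n, the parity
  -- condition needed in `depthOne_F`.
  have hodd : ∀ n, Odd n → depthOne n (projW (theta x)) = 0 := by
    intro n hn
    have h1 := evenPart_coeff (thetaPoly (x : V)) (n + 1)
    rw [hx, Polynomial.coeff_zero, thetaPoly_coeff_succ, hn.add_one.neg_one_pow] at h1
    rw [depthOne_projW_theta x n (by rintro rfl; simp at hn)]
    have h2 : (1 / ((n : ℚ) + 1)) ≠ 0 := by positivity
    have h3 : (1 + 1 : ℚ) ≠ 0 := by norm_num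
    exact (mul_eq_zero.1 ((mul_eq_zero.1 h1.symm).resolve_left h3)).resolve_left h2
  have hd := depthOne_F (augW_projW_theta x) hodd (N + 1) j
  have h1 := DeltaW_F hp (N + 1) 1 (N + j + 2) (by push_cast; omega)
  rw [F_one hN, hx, map_zero, mul_zero, map_zero] at h1
  -- Applying id ⊗ `depthOne j` to Δ(F(1)) = 0 kills the terms ỹ_b ⊗ F(1-b) and selects b = j + 1
  -- among the others, isolating F(-j).
  have h2 := congrArg
    ((TensorProduct.rid ℚ W).toLinearMap ∘ₗ TensorProduct.map LinearMap.id (depthOne j)) h1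
  rw [map_zero, map_smul, map_sum, Finset.sum_eq_single (j + 1)] at h2
  · simp only [LinearMap.comp_apply, map_add, TensorProduct.map_tmul, LinearMap.id_apply, hd,
      depthOne_yInt, LinearEquiv.coe_coe, TensorProduct.rid_tmul, zero_smul, add_zero] at h2
    rw [if_pos (by push_cast; ring), one_smul] at h2
    have h4 : (1 : ℤ) - ((j + 1 : ℕ) : ℤ) = -j := by push_cast; ring
    rw [h4] at h2
    exact (smul_eq_zero.1 h2.symm).resolve_left (by norm_num)
  · intro b _ hb
    simp only [LinearMap.comp_apply, map_add, TensorProduct.map_tmul, LinearMap.id_apply, hd,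
      depthOne_yInt, LinearEquiv.coe_coe, TensorProduct.rid_tmul, zero_smul, add_zero]
    rw [if_neg (by omega), zero_smul]
  · intro h; simp at h

theorem derW_theta_coderivation (hp : IsPrimW (projW (theta x)))
    (hx : evenPart (thetaPoly (x : V)) = 0) (w : W) :
    DeltaW (derW (theta x) w) = tensorDer (derW (theta x)) (DeltaW w) := by
  obtain ⟨N, hN⟩ := exists_taylor_eq_zero (projW (theta x))
  -- Agreement at all integers, including m ≤ 0 where both sides vanish, identifies `DeltaW_F` with
  -- the coderivation identity on generators.
  have hd : ∀ m : ℤ, derW (theta x) (yInt m) = F (projW (theta x)) (N + 1) m := by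
    intro m
    induction m using yInt_cases with
    | hneg m h =>
      obtain ⟨j, rfl⟩ : ∃ j : ℕ, m = -j := ⟨m.natAbs, by omega⟩
      rw [yInt_of_neg h, map_zero, F_nonpos_eq_zero hp hx hN]
    | h0 =>
      have := F_nonpos_eq_zero hp hx hN 0
      rw [Nat.cast_zero, neg_zero] at this
      rw [this, yInt_zero, map_neg, derivation_map_one _ (derW_mul _), neg_zero]
    | hpos n =>
      have := derW_theta_yInt x N hN n
      rwa [hx, map_zero, mul_zero, add_zero] at this
  refine coderivation_of_generators _ (derW_mul _) (fun n => ?_) w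
  have hB : (n : ℤ) + 1 < (n + N + 2 : ℕ) := by push_cast; omega
  rw [hd, DeltaW_F hp (N + 1) (n + 1) (n + N + 2) (by push_cast; omega), tensorDer,
    LinearMap.add_apply]
  conv_rhs => enter [1]; rw [DeltaW_yInt' _ _ hB]
  rw [DeltaW_yInt _ _ hB, map_smul, map_smul, map_sum, map_sum, ← smul_add,
    ← Finset.sum_add_distrib]
  simp only [TensorProduct.map_tmul, hd, LinearMap.id_apply]

/-! ## Transport to `ℳ` -/

/-- Writing v = `projW v` + a e₀, the part w a e₀ of w v disappears modulo 𝒱e₀. -/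
theorem der10M_WtoM (v : V) (w : W) :
    der10M v (WtoM w) = WtoM (derW v w + w * projW v) := by
  obtain ⟨a, ha⟩ := exists_projW_add v
  change toM (der10 v w) = toM (der1 v w + w * projW v)
  rw [der10_apply, ← sub_eq_zero, ← map_sub]
  refine (Submodule.Quotient.mk_eq_zero Ve0).2 ((mem_Ve0 _).2 ⟨(w : V) * a, ?_⟩)
  rw [mul_assoc, ← sub_eq_of_eq_add' ha, mul_sub]
  abel

theorem WtoM_one : WtoM 1 = oneM := rfl

theorem map_WtoM_injective :
    Function.Injective (TensorProduct.map WtoM WtoM : W ⊗[ℚ] W →ₗ[ℚ] M ⊗[ℚ] M) := by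
  have h : TensorProduct.map MtoW MtoW ∘ₗ TensorProduct.map WtoM WtoM = LinearMap.id := by
    rw [← TensorProduct.map_comp]
    have : MtoW ∘ₗ WtoM = LinearMap.id := LinearMap.ext MtoW_WtoM
    rw [this, TensorProduct.map_id]
  exact Function.LeftInverse.injective (g := TensorProduct.map MtoW MtoW) (DFunLike.congr_fun h)

theorem toM_mem_primM_iff (v : V) : toM v ∈ primM ↔ IsPrimW (projW v) := by
  have h : toM v = WtoM (projW v) := (WtoM_MtoW (toM v)).symm
  rw [mem_primM, h, DeltaM_WtoM, IsPrimW, ← WtoM_one, ← TensorProduct.map_tmul,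
    ← TensorProduct.map_tmul, ← map_add]
  exact map_WtoM_injective.eq_iff

/-- The endomorphism of `𝒲` corresponding to `der_v^{ℳ,(10)}`. -/
def der10W (v : V) : W →ₗ[ℚ] W := derW v + LinearMap.mulRight ℚ (projW v)

theorem mem_stabLie_iff (x : lie) :
    x ∈ stabLie DeltaM ↔
      ∀ w, DeltaW (der10W (theta x) w) = tensorDer (der10W (theta x)) (DeltaW w) := by
  have hM : ∀ w, der10M (theta x) (WtoM w) = WtoM (der10W (theta x) w) := der10M_WtoM _
  have hT : ∀ z : W ⊗[ℚ] W, tensorDer (der10M (theta x)) (TensorProduct.map WtoM WtoM z) =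
      TensorProduct.map WtoM WtoM (tensorDer (der10W (theta x)) z) := by
    intro z
    induction z using TensorProduct.induction_on with
    | zero => simp
    | add y z hy hz => rw [map_add, map_add, hy, hz, map_add, map_add]
    | tmul a b =>
      rw [TensorProduct.map_tmul, tensorDer_tmul, tensorDer_tmul, hM, hM, map_add,
        TensorProduct.map_tmul, TensorProduct.map_tmul]
  have hw : ∀ w, lieAct x DeltaM (WtoM w) = 0 ↔
      DeltaW (der10W (theta x) w) = tensorDer (der10W (theta x)) (DeltaW w) := by
    intro w
    change tensorDer (der10M (theta x)) (DeltaM (WtoM w)) -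
      DeltaM (der10M (theta x) (WtoM w)) = 0 ↔ _
    rw [sub_eq_zero, hM, DeltaM_WtoM, DeltaM_WtoM, hT, map_WtoM_injective.eq_iff, eq_comm]
  rw [mem_stabLie]
  constructor
  · intro h w
    rw [← hw, h, LinearMap.zero_apply]
  · intro h
    refine LinearMap.ext fun m => ?_
    rw [← WtoM_MtoW m, (hw _).2 (h _), LinearMap.zero_apply]

theorem tensorDer_der10W {v : V} (hp : IsPrimW (projW v)) (z : W ⊗[ℚ] W) :
    tensorDer (der10W v) z = tensorDer (derW v) z + z * DeltaW (projW v) := by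
  induction z using TensorProduct.induction_on with
  | zero => simp
  | add y z hy hz => rw [map_add, hy, hz, map_add, add_mul]; abel
  | tmul a b =>
    rw [tensorDer_tmul, tensorDer_tmul, hp, mul_add, Algebra.TensorProduct.tmul_mul_tmul,
      Algebra.TensorProduct.tmul_mul_tmul, mul_one, mul_one]
    simp only [der10W, LinearMap.add_apply, LinearMap.mulRight_apply, TensorProduct.add_tmul,
      TensorProduct.tmul_add]
    abel

theorem der10W_coderivation_iff (v : V) :
    (∀ w, DeltaW (der10W v w) = tensorDer (der10W v) (DeltaW w)) ↔
      IsPrimW (projW v) ∧ ∀ w, DeltaW (derW v w) = tensorDer (derW v) (DeltaW w) := by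
  have hiff : IsPrimW (projW v) → ∀ w, (DeltaW (der10W v w) = tensorDer (der10W v) (DeltaW w) ↔
      DeltaW (derW v w) = tensorDer (derW v) (DeltaW w)) := by
    intro hp w
    rw [tensorDer_der10W hp, der10W, LinearMap.add_apply, LinearMap.mulRight_apply, map_add,
      map_mul]
    have hc : ∀ {E : Type} [AddCommGroup E] (a b c : E), a + c = b + c ↔ a = b :=
      fun _ _ c => add_left_inj c
    exact hc (E := W ⊗[ℚ] W) _ _ _
  constructor
  · intro h
    have h1 : der10W v 1 = projW v := by
      rw [der10W, LinearMap.add_apply, derivation_map_one _ (derW_mul _), zero_add,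
        LinearMap.mulRight_apply, one_mul]
    have hp : IsPrimW (projW v) := by
      have hΔ : DeltaW 1 = 1 ⊗ₜ[ℚ] 1 := by rw [map_one, Algebra.TensorProduct.one_def]
      have := h 1
      rwa [hΔ, tensorDer_tmul, h1] at this
    exact ⟨hp, fun w => (hiff hp w).1 (h w)⟩
  · rintro ⟨hp, h⟩ w
    exact (hiff hp w).2 (h w)

theorem mem_stabLie_DeltaM_iff (x : lie) :
    x ∈ stabLie DeltaM ↔ degComp 2 (x : V) = 0 ∧ toM (theta x) ∈ primM := by
  -- The factor 1/2 in θ cancels the doubling 1 + (-1)² in the even part.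
  have h2 : (evenPart (thetaPoly (x : V))).coeff 2 = coeff (word01 1) (x : V) := by
    rw [evenPart_coeff, thetaPoly_coeff_succ]
    norm_num
    ring
  rw [mem_stabLie_iff, der10W_coderivation_iff, toM_mem_primM_iff, degComp_two_lie_eq_zero_iff,
    ← h2]
  constructor
  · rintro ⟨hp, h⟩
    exact ⟨evenPart_coeff_two_eq_zero hp h, hp⟩
  · rintro ⟨h, hp⟩
    refine ⟨hp, derW_theta_coderivation hp (Polynomial.ext fun m => ?_)⟩
    rcases eq_or_ne m 2 with rfl | hm
    · rw [h, Polynomial.coeff_zero]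
    · rw [evenPart_coeff_eq_zero hp m hm, Polynomial.coeff_zero]

end

end HarmCoprod

theorem proposition3p2 :
    HarmCoprod.stabLie HarmCoprod.DeltaM =
        Submodule.comap (HarmCoprod.toM ∘ₗ HarmCoprod.theta) HarmCoprod.primM ⊓
          HarmCoprod.lieCheck 2 ∧
      ∀ x : HarmCoprod.lie,
        x ∈ HarmCoprod.stabLie HarmCoprod.DeltaM ↔
          HarmCoprod.degComp 2 (x : HarmCoprod.V) = 0 ∧
            HarmCoprod.toM (HarmCoprod.theta x) ∈ HarmCoprod.primM := by
  refine ⟨Submodule.ext fun x => ?_, HarmCoprod.mem_stabLie_DeltaM_iff⟩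
  rw [HarmCoprod.mem_stabLie_DeltaM_iff, Submodule.mem_inf, and_comm]
  exact Iff.rfl
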